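/- Fix $t\in\mathbb N_0$ and let $\sigma=\sigma_t$ be the substitution on $\mathcal A=\{1,2,3,4,5\}$ given by $1\mapsto 1^{t+1}2,\ 2\mapsto 3,\ 3\mapsto 4,\ 4\mapsto 1^t5,\ 5\mapsto 1$, with incidence matrix $M=M_\sigma$, where $M_{b,a}$ is the number of letters $b$ in $\sigma(a)$. Let $\beta$ be the dominant eigenvalue of $M$, $f$ its minimal polynomial over $\mathbb Q$ (so $f=x^3-tx^2-(t+1)x-1$ and $\det(xI-M)=f(x)(x^2-x+1)$), $\mathbb K_e=\ker(M-\beta)$, $\mathbb K_c$ the real plane spanned by the eigenspaces of $M$ for the two conjugates of $\beta$ other than $\beta$, and $\mathbb K_n=f(M)\mathbb R^5$. Let $\pi_c$ be the projection of $\mathbb R^5=\mathbb K_c\oplus\mathbb K_e\oplus\mathbb K_n$ onto $\mathbb K_c$ along $\mathbb K_e\oplus\mathbb K_n$. For a word $w$ let $\mathbf l(w)\in\mathbb Z^5$ be the vector of its numbers of letters. Faces. Let $C_k$ be the free $\mathbb Z$-module on the faces $(\mathbf x,a_1\wedge\dots\wedge a_k)$ with $\mathbf x\in\mathbb Z^5$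 and $a_1<\dots<a_k$ in $\mathcal A$, and $C_k^*$ the free $\mathbb Z$-module on the dual faces $(\mathbf x,a_1\wedge\dots\wedge a_k)^*$. The support $\overline{(\mathbf x,a_1\wedge\dots\wedge a_k)}$ is $\{\mathbf x+\sum_i s_i\mathbf e_{a_i}:s_i\in[0,1]\}$, and the support of an element of $C_k$ is the union of the supports of the faces that occur in it with a non-zero coefficient. Define $\mathbf E_3^*(\sigma):C_3^*\to C_3^*$ by $$\mathbf E_3^*(\sigma)(\mathbf x,a_1\wedge a_2\wedge a_3)^*=\sum \mathrm{sgn}(\tau)\,\bigl(M^{-1}(\mathbf x-\mathbf l(p_1)-\mathbf l(p_2)-\mathbf l(p_3)),\,b_1\wedge b_2\wedge b_3\bigr)^*,$$ summed over all $b_1<b_2<b_3$, all permutations $\tau$ of $\{1,2,3\}$ and all decompositions $\sigma(b_i)=p_i\,a_{\tau(i)}\,s_i$ ($i=1,2,3$). Let $\varphi:C_3^*\to C_2$ be the isomorphism $(\mathbf x,a_1\wedge a_2\wedge a_3)^*\mapsto(-1)^{a_1+a_2+a_3}(\mathbf x+\mathbf e_{a_1}+\mathbf e_{a_2}+\mathbf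 e_{a_3},\,c_1\wedge c_2)$ with $c_1<c_2$ and $\{c_1,c_2\}=\mathcal A\setminus\{a_1,a_2,a_3\}$, and put $\mathbf E^2(\sigma)=\varphi\circ\mathbf E_3^*(\sigma)\circ\varphi^{-1}$. Let $$\mathcal R(a\wedge b)=\lim_{k\to\infty}M^k\,\pi_c\bigl(\overline{\mathbf E^2(\sigma)^k(\mathbf 0,a\wedge b)}\bigr)$$ (limit in the Hausdorff metric on non-empty compact sets). Let $\mathcal P=(\mathbf 0,2\wedge3)+(\mathbf 0,2\wedge4)+(\mathbf 0,3\wedge4)$ and $\mathcal R_{\mathcal P}=\mathcal R(2\wedge3)\cup\mathcal R(2\wedge4)\cup\mathcal R(3\wedge4)$. The domain exchange $E_{\mathcal P}$ translates $\mathcal R(b\wedge c)$ by $\pi_c(\mathbf e_a)$ whenever $\{a,b,c\}=\{2,3,4\}$; thus $E_{\mathcal P}(\mathcal R_{\mathcal P})$ denotes the union of the three sets $\mathcal R(b\wedge c)+\pi_c(\mathbf e_a)$. Modified stepped line. Let $u\in\mathcal A^{\mathbb N}$ be a fixed point of $\sigma$, let $\chi$ be the morphism $1\mapsto34,\ 2\mapsto2,\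 3\mapsto3,\ 4\mapsto4,\ 5\mapsto32$, and let $w=w_0w_1w_2\cdots=\chi(u)$. For $a\in\{2,3,4\}$ put $$\widetilde{\mathcal R}(a)=\overline{\{\pi_c(\mathbf l(w_0\cdots w_{N-1})):N\ge0,\ w_N=a\}},\qquad \widetilde{\mathcal R}=\widetilde{\mathcal R}(2)\cup\widetilde{\mathcal R}(3)\cup\widetilde{\mathcal R}(4).$$ **Proposition.** The limits $\mathcal R(2\wedge3)$, $\mathcal R(2\wedge4)$, $\mathcal R(3\wedge4)$ exist. For each $a\in\{2,3,4\}$, with $\{b,c\}=\{2,3,4\}\setminus\{a\}$ and $b<c$, $$\widetilde{\mathcal R}(a)+\pi_c(\mathbf e_a)=-\mathcal R(b\wedge c),$$ and $\widetilde{\mathcal R}=-E_{\mathcal P}(\mathcal R_{\mathcal P})$. -/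

import Mathlib

open scoped Pointwise

/-! Letters `1, …, n` of the alphabet are represented by `0, …, n - 1` in `Fin n`. -/

namespace Reducible

/-! ### Words and substitutions -/

/-- A substitution on `n` letters, given by the images of the letters. -/
abbrev Subst (n : ℕ) := Fin n → List (Fin n)

/-- The image of a one-sided infinite word under a substitution `τ`. If all words `τ a` are
non-empty, `τ (u_0 ⋯ u_N)` has more than `N` letters, so the default letter is never used. -/
def Subst.onInf {n : ℕ} (τ : Subst n) (u : ℕ → Fin n) : ℕ → Fin n := fun N =>
  ((List.range (N + 1)).flatMap fun i => τ (u i)).getD N (u 0)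

/-- Abelianization of a word. -/
def abel {n : ℕ} (w : List (Fin n)) : Fin n → ℤ := fun i => (w.count i : ℤ)

/-- The incidence matrix: the `(b, a)` entry is the number of letters `b` in `σ a`. -/
def incidence {n : ℕ} (σ : Subst n) : Matrix (Fin n) (Fin n) ℤ :=
  Matrix.of fun b a => ((σ a).count b : ℤ)

/-! ### Faces, dual substitutions -/

/-- The set `𝒪_k` of `a_1 ∧ ⋯ ∧ a_k` with `a_1 < ⋯ < a_k`, as sets of `k` letters. -/
abbrev Wedge (n k : ℕ) := {s : Finset (Fin n) // s.card = k}

/-- The letter `a_{i+1}` of `a_1 ∧ ⋯ ∧ a_k` (letters in increasing order). -/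
def Wedge.letter {n k : ℕ} (a : Wedge n k) (i : Fin k) : Fin n := a.1.orderEmbOfFin a.2 i

/-- The complementary wedge `a^*`. -/
def Wedge.star {n k m : ℕ} (h : k + m = n) (a : Wedge n k) : Wedge n m :=
  ⟨a.1ᶜ, by rw [Finset.card_compl, Fintype.card_fin, a.2]; omega⟩

/-- `(-1) ^ (a_1 + ⋯ + a_k)`, where the letters are numbered from `1`. -/
def Wedge.sgn {n k : ℕ} (a : Wedge n k) : ℤ := (-1) ^ (∑ i ∈ a.1, (i.val + 1))

/-- The lattice vector `e_{a_1} + ⋯ + e_{a_k}`. -/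
def Wedge.vec {n k : ℕ} (a : Wedge n k) : Fin n → ℤ := ∑ i ∈ a.1, Pi.single i 1

/-- `C_k`: formal finite integer combinations of the `k`-dimensional faces `(x, a)`. -/
abbrev Chain (n k : ℕ) := ((Fin n → ℤ) × Wedge n k) →₀ ℤ

/-- `C_k^*`: formal finite integer combinations of the dual faces `(x, a)^*`. -/
abbrev DualChain (n k : ℕ) := ((Fin n → ℤ) × Wedge n k) →₀ ℤ

/-- The dual substitution `E_k^*(σ)`. It sends `(x, a)^*` to the sum of all
`sgn(τ) (M_σ⁻¹ (x - l(p)), b)^*`, over `b ∈ 𝒪_k`, permutations `τ`, and decompositions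
`σ(b_i) = p_i a_{τ(i)} s_i`; the decomposition of `σ(b_i)` is given by the position `j i` of the
distinguished letter. -/
noncomputable def dualSubst {n : ℕ} (σ : Subst n) (k : ℕ) : DualChain n k →ₗ[ℤ] DualChain n k :=
  Finsupp.linearCombination ℤ fun F =>
    ∑ b : Wedge n k, ∑ τ : Equiv.Perm (Fin k), ∑ j : (i : Fin k) → Fin (σ (b.letter i)).length,
      if ∀ i, (σ (b.letter i)).get (j i) = F.2.letter (τ i) then
        Finsupp.single
          ((incidence σ)⁻¹.mulVec (F.1 - ∑ i, abel ((σ (b.letter i)).take (j i))), b)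
          (Equiv.Perm.sign τ : ℤ)
      else 0

/-- The Poincaré map `φ_k : C_k^* → C_{n-k}`. -/
noncomputable def poincare {n k m : ℕ} (h : k + m = n) : DualChain n k →ₗ[ℤ] Chain n m :=
  Finsupp.linearCombination ℤ fun F => Finsupp.single (F.1 + F.2.vec, F.2.star h) F.2.sgn

/-- The inverse of the Poincaré map. -/
noncomputable def poincareInv {n k m : ℕ} (h : k + m = n) : Chain n m →ₗ[ℤ] DualChain n k :=
  Finsupp.linearCombination ℤ fun F =>
    let a : Wedge n k := F.2.star ((Nat.add_comm m k).trans h)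
    Finsupp.single (F.1 - a.vec, a) a.sgn

lemma Wedge.sgn_mul_self {n k : ℕ} (a : Wedge n k) : a.sgn * a.sgn = 1 := by
  simp [Wedge.sgn, ← mul_pow]

lemma Wedge.star_star {n k m : ℕ} (h : k + m = n) (h' : m + k = n) (a : Wedge n k) :
    (a.star h).star h' = a := Subtype.ext (by simp [Wedge.star])

lemma poincareInv_comp_poincare {n k m : ℕ} (h : k + m = n) :
    poincareInv h ∘ₗ poincare h = LinearMap.id := by
  refine Finsupp.lhom_ext fun F c => ?_
  simp only [poincare, poincareInv, LinearMap.comp_apply, Finsupp.linearCombination_single,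
    Finsupp.smul_single, smul_eq_mul, Wedge.star_star, add_sub_cancel_right, LinearMap.id_apply,
    Prod.mk.eta]
  rw [mul_assoc, Wedge.sgn_mul_self, mul_one]

lemma poincare_comp_poincareInv {n k m : ℕ} (h : k + m = n) :
    poincare h ∘ₗ poincareInv h = LinearMap.id := by
  refine Finsupp.lhom_ext fun F c => ?_
  simp only [poincare, poincareInv, LinearMap.comp_apply, Finsupp.linearCombination_single,
    Finsupp.smul_single, smul_eq_mul, Wedge.star_star, sub_add_cancel, LinearMap.id_apply,
    Prod.mk.eta]
  rw [mul_assoc, Wedge.sgn_mul_self, mul_one]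

/-- The geometric dual map `E^m(σ)` on `m`-dimensional faces: the conjugate of `E_{n-m}^*(σ)` by
the Poincaré map. -/
noncomputable def geomDual {n k m : ℕ} (h : k + m = n) (σ : Subst n) : Module.End ℤ (Chain n m) :=
  poincare h ∘ₗ dualSubst σ k ∘ₗ poincareInv h

lemma geomDual_comp_poincare {n k m : ℕ} (h : k + m = n) (σ : Subst n) :
    geomDual h σ ∘ₗ poincare h = poincare h ∘ₗ dualSubst σ k := by
  rw [geomDual, LinearMap.comp_assoc, LinearMap.comp_assoc, poincareInv_comp_poincare,
    LinearMap.comp_id]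

/-- The support of a face in `ℝ^n`. -/
def faceSupport {n k : ℕ} (F : (Fin n → ℤ) × Wedge n k) : Set (Fin n → ℝ) :=
  {y | ∃ s : Fin n → ℝ, (∀ i, s i ∈ Set.Icc (0 : ℝ) 1) ∧
    y = (fun i => (F.1 i : ℝ)) + ∑ i ∈ F.2.1, s i • Pi.single i (1 : ℝ)}

/-- The support of a formal combination of faces. -/
def chainSupport {n k : ℕ} (c : Chain n k) : Set (Fin n → ℝ) := ⋃ F ∈ c.support, faceSupport F

/-! ### The invariant spaces and the projection to the contracting space -/

/-- `M_σ` acting on `ℝ^n`. -/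
noncomputable def action {n : ℕ} (σ : Subst n) : Module.End ℝ (Fin n → ℝ) :=
  Matrix.toLin' ((incidence σ).map (Int.cast : ℤ → ℝ))

/-- The dominant eigenvalue of `M_σ` (for a primitive non-negative matrix this is its largest real
eigenvalue). -/
noncomputable def pisotRoot {n : ℕ} (σ : Subst n) : ℝ :=
  sSup {x : ℝ | Polynomial.aeval x (incidence σ).charpoly = 0}

/-- The Pisot polynomial `f`: the minimal polynomial over `ℚ` of the dominant eigenvalue,
seen as a real polynomial. -/
noncomputable def pisotPoly {n : ℕ} (σ : Subst n) : Polynomial ℝ :=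
  (minpoly ℚ (pisotRoot σ)).map (algebraMap ℚ ℝ)

/-- The expanding line `𝕂_e`: the eigenspace of the dominant eigenvalue `β`. -/
noncomputable def Ke {n : ℕ} (σ : Subst n) : Submodule ℝ (Fin n → ℝ) :=
  LinearMap.ker (Polynomial.aeval (action σ) (Polynomial.X - Polynomial.C (pisotRoot σ)))

/-- The contracting space `𝕂_c`, the (real) sum of the eigenspaces of the conjugates of `β` other
than `β`: the kernel of `(f / (X - β))(M_σ)`. -/
noncomputable def Kc {n : ℕ} (σ : Subst n) : Submodule ℝ (Fin n → ℝ) :=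
  LinearMap.ker (Polynomial.aeval (action σ)
    (pisotPoly σ /ₘ (Polynomial.X - Polynomial.C (pisotRoot σ))))

/-- The neutral space `𝕂_n = f(M_σ) ℝ^n`. -/
noncomputable def Kn {n : ℕ} (σ : Subst n) : Submodule ℝ (Fin n → ℝ) :=
  LinearMap.range (Polynomial.aeval (action σ) (pisotPoly σ))

/-! ### The family `σ_t` -/

/-- `σ_t : 1 ↦ 1^{t+1} 2, 2 ↦ 3, 3 ↦ 4, 4 ↦ 1^t 5, 5 ↦ 1`. -/
def sigma (t : ℕ) : Subst 5 :=
  ![List.replicate (t + 1) 0 ++ [1], [2], [3], List.replicate t 0 ++ [4], [0]]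

/-- The morphism `χ : 1 ↦ 34, 2 ↦ 2, 3 ↦ 3, 4 ↦ 4, 5 ↦ 32`. -/
def chi : Subst 5 := ![[2, 3], [1], [2], [3], [2, 1]]

/-- Each `σ_t` has a one-sided fixed point. -/
lemma exists_fixedPoint (t : ℕ) : ∃ u : ℕ → Fin 5, (sigma t).onInf u = u := by
  let W : ℕ → List (Fin 5) := fun k => (fun w => w.flatMap (sigma t))^[k] [0]
  have hS : ∀ k, W (k + 1) = (W k).flatMap (sigma t) := fun k =>
    Function.iterate_succ_apply' _ _ _
  have hpos : ∀ a, 1 ≤ (sigma t a).length := by intro a; fin_cases a <;> simp [sigma]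
  have hlen : ∀ w : List (Fin 5), w.length ≤ (w.flatMap (sigma t)).length := by
    intro w
    induction w with
    | nil => simp
    | cons a w ih => have := hpos a; simp only [List.flatMap_cons, List.length_append,
        List.length_cons]; omega
  have hpre : ∀ k, W k <+: W (k + 1) := by
    intro k
    induction k with
    | zero => exact ⟨List.replicate t 0 ++ [1], by simp [W, sigma, List.replicate_succ]⟩
    | succ k ih =>
      obtain ⟨s, hs⟩ := ih
      rw [hS (k + 1), ← hs, List.flatMap_append, ← hS k, hs]
      exact List.prefix_append _ _
  have hstart : ∀ k, ∃ w, W k = 0 :: w := by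
    intro k
    induction k with
    | zero => exact ⟨[], rfl⟩
    | succ k ih =>
      obtain ⟨w, hw⟩ := ih
      obtain ⟨s, hs⟩ := hpre k
      exact ⟨w ++ s, by rw [← hs, hw]; rfl⟩
  have hWlen : ∀ k, k + 1 ≤ (W k).length := by
    intro k
    induction k with
    | zero => simp [W]
    | succ k ih =>
      obtain ⟨w, hw⟩ := hstart k
      have := hlen w
      rw [hS, hw, List.flatMap_cons, List.length_append]
      rw [hw, List.length_cons] at ih
      have : (sigma t 0).length = t + 2 := by simp [sigma]
      omega
  have hmono : ∀ k l, k ≤ l → W k <+: W l := by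
    intro k l h
    induction h with
    | refl => exact List.prefix_rfl
    | step _ ih => exact ih.trans (hpre _)
  have hu : ∀ k i, i < (W k).length → ∀ l, i < (W l).length → (W k)[i]! = (W l)[i]! := by
    intro k i hi l hl
    rcases le_total k l with h | h
    · have := (hmono k l h).getElem hi
      simp [hi, hl, this]
    · have := (hmono l k h).getElem hl
      simp [hi, hl, this]
  refine ⟨fun N => (W N)[N]!, funext fun N => ?_⟩
  have hmap : (List.range (N + 1)).map (fun i => (W i)[i]!) = (W N).take (N + 1) := by
    apply List.ext_getElem
    · have := hWlen N; simp; omega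
    · intro i h1 h2
      have hi : i < N + 1 := by simpa using h1
      have := hu i i (hWlen i) N (hi.trans_le (hWlen N))
      have h3 := hi.trans_le (hWlen N)
      simp only [List.getElem_map, List.getElem_range, List.getElem_take, this]
      exact getElem!_pos (W N) i h3
  have hfl : (List.range (N + 1)).flatMap (fun i => sigma t (W i)[i]!) =
      ((W N).take (N + 1)).flatMap (sigma t) := by
    rw [← hmap, List.flatMap_map]
  have h1 : N < (((W N).take (N + 1)).flatMap (sigma t)).length := by
    have := hlen ((W N).take (N + 1))
    have := hWlen N
    simp only [List.length_take] at *
    omega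
  have h2 : ((W N).take (N + 1)).flatMap (sigma t) <+: W (N + 1) := by
    rw [hS]
    conv_rhs => rw [← List.take_append_drop (N + 1) (W N), List.flatMap_append]
    exact List.prefix_append _ _
  have h3 : N < (W (N + 1)).length := h1.trans_le h2.length_le
  have h4 := h2.getElem h1
  have h5 := hu N N (hWlen N) (N + 1) h3
  simp only [Subst.onInf, hfl]
  rw [h5]
  rw [List.getD_eq_getElem _ _ h1, h4, getElem!_pos (W (N + 1)) N h3]

lemma incidence_sigma (t : ℕ) : incidence (sigma t) =
    !![(t : ℤ) + 1, 0, 0, t, 1; 1, 0, 0, 0, 0; 0, 1, 0, 0, 0; 0, 0, 1, 0, 0; 0, 0, 0, 1, 0] := by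
  ext i j
  fin_cases i <;> fin_cases j <;>
    simp [incidence, sigma, List.count_append, List.count_replicate]

open Polynomial in
lemma charpoly_sigma (t : ℕ) : (incidence (sigma t)).charpoly =
    (X ^ 3 - C (t : ℤ) * X ^ 2 - C ((t : ℤ) + 1) * X - 1) * (X ^ 2 - X + 1) := by
  rw [incidence_sigma, Matrix.charpoly]
  simp [Matrix.charmatrix, Matrix.det_succ_row_zero, Fin.sum_univ_succ, Fin.succAbove]
  ring

lemma isUnit_det_incidence_sigma (t : ℕ) : IsUnit (incidence (sigma t)).det := by
  rw [incidence_sigma]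
  simp [Matrix.det_succ_row_zero, Fin.sum_univ_succ, Fin.succAbove]

open Polynomial in
/-- The minimal polynomial of a real root of `X ^ 3 - t X ^ 2 - (t + 1) X - 1`. -/
lemma minpoly_sigma_aux (t : ℕ) {x : ℝ} (hx : x ^ 3 - t * x ^ 2 - (t + 1) * x - 1 = 0) :
    minpoly ℚ x = X ^ 3 - C (t : ℚ) * X ^ 2 - C ((t : ℚ) + 1) * X - 1 := by
  set p : ℚ[X] := X ^ 3 - C (t : ℚ) * X ^ 2 - C ((t : ℚ) + 1) * X - 1 with hp
  have hd : p.natDegree = 3 := by rw [hp]; compute_degree!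
  have hm : p.Monic := by rw [hp]; monicity!
  have hirr : Irreducible p := by
    refine irreducible_of_degree_le_three_of_not_isRoot (by simp [hd]) fun y hy => ?_
    set P : ℤ[X] := X ^ 3 - C (t : ℤ) * X ^ 2 - C ((t : ℤ) + 1) * X - 1 with hP
    have hPm : P.Monic := by rw [hP]; monicity!
    have hy' : y ^ 3 - t * y ^ 2 - (t + 1) * y - 1 = 0 := by simpa [hp] using hy
    obtain ⟨z, rfl⟩ := isInteger_of_is_root_of_monic hPm (r := y) (by simp [hP, hy'])
    have hz : z ^ 3 - t * z ^ 2 - (t + 1) * z - 1 = 0 := by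
      simp only [eq_intCast] at hy'
      exact_mod_cast hy'
    have h1 : z * (z ^ 2 - t * z - (t + 1)) = 1 := by linear_combination hz
    rcases Int.isUnit_iff.1 (IsUnit.of_mul_eq_one _ h1) with rfl | rfl <;> grind
  refine (minpoly.eq_of_irreducible_of_monic hirr ?_ hm).symm
  simp [hp, hx]

open Polynomial in
lemma pisotRoot_sigma (t : ℕ) : (pisotRoot (sigma t)) ^ 3 - t * (pisotRoot (sigma t)) ^ 2
    - (t + 1) * pisotRoot (sigma t) - 1 = 0 ∧ 1 < pisotRoot (sigma t) := by
  have hset : {x : ℝ | aeval x (incidence (sigma t)).charpoly = 0} =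
      {x : ℝ | x ^ 3 - t * x ^ 2 - (t + 1) * x - 1 = 0} := by
    ext x
    have : x ^ 2 - x + 1 ≠ 0 := by nlinarith [sq_nonneg (x - 1 / 2)]
    simp [charpoly_sigma, this]
  have hfin : {x : ℝ | x ^ 3 - t * x ^ 2 - (t + 1) * x - 1 = 0}.Finite := by
    rw [← hset]
    refine ((incidence (sigma t)).charpoly.map (algebraMap ℤ ℝ)).roots.toFinset.finite_toSet.subset
      fun x hx => ?_
    have h0 := ((incidence (sigma t)).charpoly_monic.map (algebraMap ℤ ℝ)).ne_zero
    simp only [Finset.mem_coe, Multiset.mem_toFinset, mem_roots h0, IsRoot.def, eval_map]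
    exact hx
  obtain ⟨x, hx1, hx⟩ : ∃ x : ℝ, 1 < x ∧ x ^ 3 - t * x ^ 2 - (t + 1) * x - 1 = 0 := by
    have ht : (0 : ℝ) ≤ t := t.cast_nonneg
    have hc : ContinuousOn (fun x : ℝ => x ^ 3 - t * x ^ 2 - (t + 1) * x - 1)
        (Set.Icc 1 (t + 3)) := by fun_prop
    obtain ⟨x, hx, h⟩ := intermediate_value_Icc (by linarith) hc
      (show (0 : ℝ) ∈ Set.Icc _ _ by
        constructor
        · simp; linarith
        · nlinarith [mul_nonneg ht ht])
    refine ⟨x, lt_of_le_of_ne hx.1 ?_, h⟩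
    rintro rfl
    linarith
  rw [pisotRoot, hset]
  exact ⟨(Set.Nonempty.csSup_mem ⟨x, hx⟩ hfin), hx1.trans_le (le_csSup hfin.bddAbove hx)⟩

open Polynomial in
lemma minpoly_sigma (t : ℕ) : minpoly ℚ (pisotRoot (sigma t)) =
    X ^ 3 - C (t : ℚ) * X ^ 2 - C ((t : ℚ) + 1) * X - 1 :=
  minpoly_sigma_aux t (pisotRoot_sigma t).1

open Polynomial in
/-- `ℝ^5 = 𝕂_c ⊕ (𝕂_e ⊕ 𝕂_n)` for the substitution `σ_t`. -/
lemma isCompl_sigma (t : ℕ) : IsCompl (Kc (sigma t)) (Ke (sigma t) ⊔ Kn (sigma t)) := by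
  obtain ⟨hroot, -⟩ := pisotRoot_sigma t
  set β := pisotRoot (sigma t) with hβ
  set A := action (sigma t) with hA
  set f : ℝ[X] := X ^ 3 - C (t : ℝ) * X ^ 2 - C ((t : ℝ) + 1) * X - 1 with hf
  set g : ℝ[X] := X ^ 2 - X + 1 with hg
  have hpf : pisotPoly (sigma t) = f := by
    rw [pisotPoly, minpoly_sigma, hf]; simp
  have hirr : Irreducible (minpoly ℚ β) := by
    refine minpoly.irreducible ?_
    by_contra h
    have h3 := congrArg (fun p : ℚ[X] => p.coeff 3) (minpoly_sigma t)
    simp [minpoly.eq_zero h, ← hβ, coeff_one] at h3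
  set q := f /ₘ (X - C β) with hq
  have hfq : (X - C β) * q = f := by
    rw [hq, mul_divByMonic_eq_iff_isRoot]; simp [hf, hroot]
  have hsep : ((X - C β) * q).Separable := by
    rw [hfq, ← hpf]; exact hirr.separable.map
  have hc1 : IsCoprime (X - C β) q := hsep.isCoprime
  have hc2 : IsCoprime f g := by
    have hR : (3 * (t : ℝ) ^ 2 + 3 * t + 7) ≠ 0 := by positivity
    refine ⟨C (3 * (t : ℝ) ^ 2 + 3 * t + 7)⁻¹ * (C (2 * (t : ℝ) + 1) * X - C ((t : ℝ) + 3)),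
      C (3 * (t : ℝ) ^ 2 + 3 * t + 7)⁻¹ * (C ((2 * (t : ℝ) + 1) ^ 2) -
        (X + 1 - C (t : ℝ)) * (C (2 * (t : ℝ) + 1) * X - C ((t : ℝ) + 3))), ?_⟩
    have h1 : (C (3 * (t : ℝ) ^ 2 + 3 * t + 7)⁻¹ * C (3 * (t : ℝ) ^ 2 + 3 * t + 7) : ℝ[X]) = 1 := by
      rw [← C_mul, inv_mul_cancel₀ hR, C_1]
    refine Eq.trans ?_ h1
    rw [hf, hg]
    simp only [C_add, C_mul, C_pow, C_1, C_ofNat]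
    ring
  have hCH : aeval A (f * g) = 0 := by
    have h1 : A.charpoly = f * g := by
      rw [hA, action, Matrix.charpoly_toLin']
      change ((incidence (sigma t)).map (Int.castRingHom ℝ)).charpoly = _
      rw [Matrix.charpoly_map, charpoly_sigma, hf, hg]
      simp
    rw [← h1, LinearMap.aeval_self_charpoly]
  rw [← hfq] at hc2
  have hc3 : IsCoprime q ((X - C β) * g) :=
    IsCoprime.mul_right hc1.symm hc2.of_mul_left_right
  have hKn : Kn (sigma t) = LinearMap.ker (aeval A g) := by
    rw [Kn, hpf, ← hA, ← hfq]
    ext x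
    constructor
    · rintro ⟨y, rfl⟩
      rw [LinearMap.mem_ker, ← Module.End.mul_apply, ← map_mul, hfq, mul_comm, hCH]; rfl
    · intro hx
      obtain ⟨a, b, hab⟩ := hc2
      refine ⟨aeval A a x, ?_⟩
      have := congrArg (fun p => aeval A p x) hab
      simp only [map_add, map_mul, LinearMap.add_apply, Module.End.mul_apply, map_one,
        Module.End.one_apply] at this
      rw [LinearMap.mem_ker.1 hx, map_zero, add_zero] at this
      rw [← Module.End.mul_apply, ← map_mul, mul_comm, map_mul, Module.End.mul_apply, map_mul,
        Module.End.mul_apply, this]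
  have hKc : Kc (sigma t) = LinearMap.ker (aeval A q) := by rw [Kc, hpf]
  have hKe : Ke (sigma t) = LinearMap.ker (aeval A (X - C β)) := rfl
  rw [hKn, hKc, hKe, sup_ker_aeval_eq_ker_aeval_mul_of_coprime A hc2.of_mul_left_left]
  refine ⟨disjoint_ker_aeval_of_isCoprime A hc3, codisjoint_iff.2 ?_⟩
  rw [sup_ker_aeval_eq_ker_aeval_mul_of_coprime A hc3, ← mul_assoc, mul_comm q, hfq, hCH,
    LinearMap.ker_zero]

/-- The projection `π_c : ℝ^5 → 𝕂_c` along `𝕂_e ⊕ 𝕂_n`, for `σ_t`. -/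
noncomputable def piC (t : ℕ) : (Fin 5 → ℝ) →ₗ[ℝ] (Fin 5 → ℝ) :=
  (Kc (sigma t)).projection (Ke (sigma t) ⊔ Kn (sigma t)) (isCompl_sigma t)

/-! ### Rauzy fractals of the geometric dual map `E^2(σ_t)` -/

/-- `K` is a non-empty compact set and `A k` tends to `K` in the Hausdorff metric. -/
def IsHausdorffLimit {X : Type*} [PseudoEMetricSpace X] (A : ℕ → Set X) (K : Set X) : Prop :=
  K.Nonempty ∧ IsCompact K ∧
    Filter.Tendsto (fun k => Metric.hausdorffEDist (A k) K) Filter.atTop (nhds 0)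

/-- A Hausdorff limit is unique. -/
lemma IsHausdorffLimit.unique {X : Type*} [EMetricSpace X] {A : ℕ → Set X} {K L : Set X}
    (hK : IsHausdorffLimit A K) (hL : IsHausdorffLimit A L) : K = L := by
  have h := hK.2.2.add hL.2.2
  have h0 : Metric.hausdorffEDist K L ≤ 0 := by
    refine ge_of_tendsto' (by simpa using h) fun k => ?_
    rw [@Metric.hausdorffEDist_comm X _ (A k) K]
    exact Metric.hausdorffEDist_triangle
  exact (hK.2.1.isClosed.hausdorffEDist_zero_iff hL.2.1.isClosed).1 (le_antisymm h0 bot_le)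

/-- The approximations `M_σ^k π_c(supp (E^2(σ_t)^k (0, a)))`. -/
noncomputable def rauzyApprox (t : ℕ) (a : Wedge 5 2) (k : ℕ) : Set (Fin 5 → ℝ) :=
  (action (sigma t) ^ k) '' (piC t ''
    chainSupport ((geomDual (show 3 + 2 = 5 from rfl) (sigma t) ^ k) (Finsupp.single (0, a) 1)))

/-- The Rauzy fractal `R(a)`, `a ∈ 𝒪_2`: the Hausdorff limit of the approximations. -/
noncomputable def rauzyTile (t : ℕ) (a : Wedge 5 2) : Set (Fin 5 → ℝ) :=
  Classical.epsilon (IsHausdorffLimit (rauzyApprox t a))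

/-- `R_P`: the union of the `R(a)` over the faces `(0, a)` of `P`. -/
noncomputable def rauzyUnion (t : ℕ) (P : Chain 5 2) : Set (Fin 5 → ℝ) :=
  ⋃ a ∈ {a : Wedge 5 2 | (0, a) ∈ P.support}, rauzyTile t a

/-- The alphabet `𝒜_P` of the letters appearing in the types of the faces of `P`. -/
def alphabet (P : Chain 5 2) : Finset (Fin 5) := P.support.biUnion fun F => F.2.1

/-- The domain exchange `E_P`, as a relation: `x ∈ R(a)` is sent to `x + π_c(e_ℓ)`, for each face
`(0, a)` of `P` with `x ∈ R(a)`, where `ℓ` is the letter of `𝒜_P` that does not occur in `a`. -/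
noncomputable def domainExchange (t : ℕ) (P : Chain 5 2) : SetRel (Fin 5 → ℝ) (Fin 5 → ℝ) :=
  {p | ∃ a : Wedge 5 2, (0, a) ∈ P.support ∧ p.1 ∈ rauzyTile t a ∧
    ∃ l ∈ alphabet P \ a.1, p.2 = p.1 + piC t (Pi.single l 1)}

/-- `P = (0, 2 ∧ 3) + (0, 2 ∧ 4) + (0, 3 ∧ 4)`. -/
noncomputable def elementP : Chain 5 2 :=
  Finsupp.single (0, ⟨{1, 2}, rfl⟩) 1 + Finsupp.single (0, ⟨{1, 3}, rfl⟩) 1 +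
    Finsupp.single (0, ⟨{2, 3}, rfl⟩) 1

/-! ### The modified stepped line -/

/-- The set of all `π_c(l(w_0 ⋯ w_{N-1}))` with `w_N = a`, closed up, for `w = χ(u)`. -/
noncomputable def lineTile (t : ℕ) (u : ℕ → Fin 5) (a : Fin 5) : Set (Fin 5 → ℝ) :=
  closure {y | ∃ N : ℕ, chi.onInf u N = a ∧
    y = piC t fun i => (abel ((List.range N).map (chi.onInf u)) i : ℝ)}

end Reducible

namespace Reducible

/-! ### Words -/

/-! Letters are numbered from 0, `π` stands for `π_c`, and `e_i` also denotes `π e_i`. Both sides of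
the identity are computed from the subtiles `F(c)`, the sets of points `π(l(u_0 ⋯ u_N))` with `u_N =
c`. Since `u` is fixed by `σ`, they satisfy `F(a) = ⋃ (M F(c) - π l(r))` over all decompositions
`σ(c) = p a r`.

The reducibility of `M` enters through two relations. The vectors `e_0 - e_2 - e_3` and `e_4 - e_1 -
e_2` lie in the neutral space, so `π` kills them. These are the relations that `χ` imposes: its
incidence matrix acts as the identity after `π`. Hence the projected prefixes of `χ(u)` ending in
`a` form a union of translates of subtiles, which is called `D({0,a,4})`
(`latticeProj_prefixSet_chi`).

On the dual side, one step of `E_3^*(σ)` sends a type `a` to types `b` with a vector `v` that is the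
sum of three suffixes. The key point is that `D` extends from the three types `{0,a,4}` to all ten
types, as explicit unions built from the `F(c)`, so that `D(a) = ⋃ (M D(b) - π v)` over all
successors `(b, v)` of `a` (`IsTileFamily.mem_dualTile`). This uses only the equations of the `F(c)`
and the two relations. It holds exactly for the sets before closure.

Iterating this equation `k` times along a path of faces from `(0, a)` to a face at `z` of type `b`
telescopes to `M^k(π z - y) = -x` with `x ∈ D(a)`, `y ∈ D(b)`; every `y` in the end tile yields such
an `x`, and every `x` lies on such a path. As `M` contracts `𝕂_c` exponentially and the tiles are
bounded, the `k`-th approximation is within a constant times `ρ^k` of `-D`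
(`isHausdorffLimit_rauzyApprox`). So the limit exists and equals the closure of `-D` at the
complementary type. The iterates can be treated as sets of faces because every permutation occurring
in `E_3^*(σ_t)` is even, so that nothing cancels (`onlyEven_sigma`). -/

lemma abel_append {n : ℕ} (v w : List (Fin n)) : abel (v ++ w) = abel v + abel w := by
  ext i; simp [abel]

lemma abel_nil {n : ℕ} : abel ([] : List (Fin n)) = 0 := by
  ext i; simp [abel]

lemma abel_cons {n : ℕ} (a : Fin n) (w : List (Fin n)) :
    abel (a :: w) = Pi.single a 1 + abel w := by
  ext i
  by_cases h : i = a
  · subst h; simp [abel, add_comm]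
  · simp [abel, h, Ne.symm h]

lemma incidence_mulVec_single {n : ℕ} (σ : Subst n) (b : Fin n) :
    (incidence σ).mulVec (Pi.single b 1) = abel (σ b) := by
  ext i; simp [incidence, abel]

lemma abel_flatMap {n : ℕ} (σ : Subst n) (w : List (Fin n)) :
    abel (w.flatMap σ) = (incidence σ).mulVec (abel w) := by
  induction w with
  | nil => simp [abel_nil]
  | cons a w ih =>
    rw [List.flatMap_cons, abel_append, ih, abel_cons, Matrix.mulVec_add, incidence_mulVec_single]

/-- The letter `a` occurs in `σ c`, followed by a word with abelianization `s`. -/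
def Occ {n : ℕ} (σ : Subst n) (c a : Fin n) (s : Fin n → ℤ) : Prop :=
  ∃ p r, σ c = p ++ a :: r ∧ s = abel r

/-- The dual substitution records a position and its prefix, the set equations use the suffix; each
determines the other through `l(σ c) = l(p) + e_a + l(r)`. -/
lemma occ_iff_get {n : ℕ} {σ : Subst n} {c a : Fin n} {s : Fin n → ℤ} :
    Occ σ c a s ↔ ∃ j : Fin (σ c).length, (σ c).get j = a ∧
      (incidence σ).mulVec (Pi.single c 1) =
        abel ((σ c).take j) + Pi.single a 1 + s := by
  have key : ∀ j : Fin (σ c).length, σ c = (σ c).take j ++ (σ c).get j :: (σ c).drop (j + 1) := by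
    intro j
    rw [List.get_eq_getElem, List.cons_getElem_drop_succ, List.take_append_drop]
  constructor
  · rintro ⟨p, r, h, rfl⟩
    refine ⟨⟨p.length, by simp [h]⟩, by simp [h], ?_⟩
    rw [incidence_mulVec_single]
    simp only [h, List.take_left', abel_append, abel_cons, add_assoc]
  · rintro ⟨j, rfl, h⟩
    refine ⟨_, _, key j, ?_⟩
    rw [incidence_mulVec_single] at h
    nth_rw 1 [key j] at h
    rw [abel_append, abel_cons, add_assoc] at h
    exact (add_left_cancel (add_left_cancel h)).symm

/-! ### Supports of iterated dual substitutions -/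

/-- `b` is the type of a term of `E_k^*(σ) (x, a)^*`, and `v` is the abelianization of the
concatenated suffixes. -/
def Succ {n : ℕ} (σ : Subst n) {k : ℕ} (a b : Wedge n k) (v : Fin n → ℤ) : Prop :=
  ∃ (τ : Equiv.Perm (Fin k)) (s : Fin k → Fin n → ℤ),
    (∀ i, Occ σ (b.letter i) (a.letter (τ i)) (s i)) ∧ v = ∑ i, s i

/-- `G` is a term of `E_k^*(σ) F`. -/
def Step {n : ℕ} (σ : Subst n) {k : ℕ} (F G : (Fin n → ℤ) × Wedge n k) : Prop :=
  ∃ v, Succ σ F.2 G.2 v ∧ (incidence σ).mulVec (G.1 + G.2.vec) = F.1 + F.2.vec + v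

/-- `G` is reached from `F` by `m` steps. -/
def Reach {n : ℕ} (σ : Subst n) {k : ℕ} :
    ℕ → ((Fin n → ℤ) × Wedge n k) → ((Fin n → ℤ) × Wedge n k) → Prop
  | 0, F, G => F = G
  | m + 1, F, G => ∃ H, Step σ F H ∧ Reach σ m H G

/-- All permutations that occur in the definition of `E_k^*(σ)` are even. -/
def OnlyEven {n : ℕ} (σ : Subst n) (k : ℕ) : Prop :=
  ∀ (a b : Wedge n k) (τ : Equiv.Perm (Fin k)),
    (∀ i, ∃ s, Occ σ (b.letter i) (a.letter (τ i)) s) → Equiv.Perm.sign τ = 1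

lemma Wedge.sum_letter {n k : ℕ} (a : Wedge n k) :
    ∑ i, Pi.single (a.letter i) (1 : ℤ) = a.vec := by
  rw [Wedge.vec, ← Finset.map_orderEmbOfFin_univ a.1 a.2, Finset.sum_map]
  rfl

lemma exists_occ_get {n : ℕ} {σ : Subst n} {c a : Fin n} (j : Fin (σ c).length)
    (h : (σ c).get j = a) : ∃ s, Occ σ c a s := by
  refine ⟨(incidence σ).mulVec (Pi.single c 1) - (abel ((σ c).take j) + Pi.single a 1), ?_⟩
  exact occ_iff_get.2 ⟨j, h, by abel⟩

/-- Non-negative coefficients cannot cancel, so the support of the sum is the union of the supports.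
-/
lemma mem_support_sum_of_nonneg {ι α : Type*} {s : Finset ι} {f : ι → α →₀ ℤ}
    (hf : ∀ i ∈ s, 0 ≤ f i) {x : α} :
    x ∈ (∑ i ∈ s, f i).support ↔ ∃ i ∈ s, x ∈ (f i).support := by
  rw [Finsupp.mem_support_iff, Finsupp.finsetSum_apply, ne_eq,
    Finset.sum_eq_zero_iff_of_nonneg fun i hi => hf i hi x]
  simp

lemma dualSubst_single {n : ℕ} (σ : Subst n) (k : ℕ) (F : (Fin n → ℤ) × Wedge n k) :
    dualSubst σ k (Finsupp.single F 1) =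
    ∑ b : Wedge n k, ∑ τ : Equiv.Perm (Fin k), ∑ j : (i : Fin k) → Fin (σ (b.letter i)).length,
      if ∀ i, (σ (b.letter i)).get (j i) = F.2.letter (τ i) then
        Finsupp.single
          ((incidence σ)⁻¹.mulVec (F.1 - ∑ i, abel ((σ (b.letter i)).take (j i))), b)
          (Equiv.Perm.sign τ : ℤ)
      else 0 := by
  simp [dualSubst]

lemma dualSubst_term_nonneg {n : ℕ} {σ : Subst n} {k : ℕ} (hσ : OnlyEven σ k)
    (F : (Fin n → ℤ) × Wedge n k) (b : Wedge n k) (τ : Equiv.Perm (Fin k))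
    (j : (i : Fin k) → Fin (σ (b.letter i)).length) :
    0 ≤ if ∀ i, (σ (b.letter i)).get (j i) = F.2.letter (τ i) then
        Finsupp.single
          ((incidence σ)⁻¹.mulVec (F.1 - ∑ i, abel ((σ (b.letter i)).take (j i))), b)
          (Equiv.Perm.sign τ : ℤ)
      else 0 := by
  split_ifs with h
  · rw [hσ F.2 b τ fun i => exists_occ_get (j i) (h i)]
    simp
  · exact le_rfl

lemma dualSubst_single_nonneg {n : ℕ} {σ : Subst n} {k : ℕ} (hσ : OnlyEven σ k)
    (F : (Fin n → ℤ) × Wedge n k) : 0 ≤ dualSubst σ k (Finsupp.single F 1) := by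
  rw [dualSubst_single]
  exact Finset.sum_nonneg fun b _ => Finset.sum_nonneg fun τ _ => Finset.sum_nonneg fun j _ =>
    dualSubst_term_nonneg hσ F b τ j

/-- Adding `M b.vec = ∑ q + a.vec + ∑ s` to `M y = x - ∑ q` cancels the prefixes. Positions shifted
by the vector of their wedge, as the Poincaré map does, therefore evolve through the suffixes alone,
and `τ` disappears on summation. -/
lemma step_position_iff {n : ℕ} {σ : Subst n} (hdet : IsUnit (incidence σ).det) {k : ℕ}
    (x y v : Fin n → ℤ) (a b : Wedge n k) (τ : Equiv.Perm (Fin k)) (q s : Fin k → Fin n → ℤ)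
    (h : ∀ i, (incidence σ).mulVec (Pi.single (b.letter i) 1) =
      q i + Pi.single (a.letter (τ i)) 1 + s i) (hv : v = ∑ i, s i) :
    y = (incidence σ)⁻¹.mulVec (x - ∑ i, q i) ↔
      (incidence σ).mulVec (y + b.vec) = x + a.vec + v := by
  have hb : (incidence σ).mulVec b.vec = ∑ i, q i + a.vec + v := by
    rw [← Wedge.sum_letter b, Matrix.mulVec_sum, Finset.sum_congr rfl fun i _ => h i,
      Finset.sum_add_distrib, Finset.sum_add_distrib, ← hv,
      Equiv.sum_comp τ fun i => (Pi.single (a.letter i) 1 : Fin n → ℤ), Wedge.sum_letter]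
  rw [Matrix.mulVec_add, hb]
  constructor
  · rintro rfl
    rw [Matrix.mulVec_mulVec, Matrix.mul_nonsing_inv _ hdet, Matrix.one_mulVec]
    abel
  · intro h'
    have : (incidence σ).mulVec y = x - ∑ i, q i := by
      rw [eq_sub_iff_add_eq]
      apply add_right_cancel (b := a.vec + v)
      rw [← add_assoc x, ← h']
      abel
    rw [← this, Matrix.mulVec_mulVec, Matrix.nonsing_inv_mul _ hdet, Matrix.one_mulVec]

lemma mem_support_dualSubst_single {n : ℕ} {σ : Subst n} (hdet : IsUnit (incidence σ).det)
    {k : ℕ} (hσ : OnlyEven σ k) (F G : (Fin n → ℤ) × Wedge n k) :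
    G ∈ (dualSubst σ k (Finsupp.single F 1)).support ↔ Step σ F G := by
  rw [dualSubst_single, mem_support_sum_of_nonneg fun b _ => Finset.sum_nonneg fun τ _ =>
    Finset.sum_nonneg fun j _ => dualSubst_term_nonneg hσ F b τ j]
  simp_rw [mem_support_sum_of_nonneg fun τ _ => Finset.sum_nonneg fun j _ =>
    dualSubst_term_nonneg hσ F _ τ j, mem_support_sum_of_nonneg fun j _ =>
    dualSubst_term_nonneg hσ F _ _ j]
  constructor
  · rintro ⟨b, -, τ, -, j, -, h⟩
    split_ifs at h with hj
    · have hG := Finset.mem_singleton.1 (Finsupp.support_single_subset h)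
      let s : Fin k → Fin n → ℤ := fun i => (incidence σ).mulVec (Pi.single (b.letter i) 1) -
        (abel ((σ (b.letter i)).take (j i)) + Pi.single (F.2.letter (τ i)) 1)
      have hs : ∀ i, (incidence σ).mulVec (Pi.single (b.letter i) 1) =
          abel ((σ (b.letter i)).take (j i)) + Pi.single (F.2.letter (τ i)) 1 + s i := fun i => by
        simp only [s]; abel
      subst hG
      exact ⟨_, ⟨τ, s, fun i => occ_iff_get.2 ⟨j i, hj i, hs i⟩, rfl⟩,
        (step_position_iff hdet _ _ _ _ _ τ _ s hs rfl).1 rfl⟩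
    · simp at h
  · rintro ⟨v, ⟨τ, s, hs, hv⟩, hG⟩
    choose j hj hs' using fun i => occ_iff_get.1 (hs i)
    refine ⟨G.2, Finset.mem_univ _, τ, Finset.mem_univ _, j, Finset.mem_univ _, ?_⟩
    rw [if_pos hj, ← (step_position_iff hdet _ _ _ _ _ τ _ s hs' hv).2 hG]
    simp

lemma dualSubst_eq_sum {n : ℕ} (σ : Subst n) (k : ℕ) (c : DualChain n k) :
    dualSubst σ k c = ∑ F ∈ c.support, c F • dualSubst σ k (Finsupp.single F 1) := by
  conv_lhs => rw [← Finsupp.sum_single c, Finsupp.sum, map_sum]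
  refine Finset.sum_congr rfl fun F _ => ?_
  rw [← map_smul, Finsupp.smul_single, smul_eq_mul, mul_one]

lemma dualSubst_nonneg {n : ℕ} {σ : Subst n} {k : ℕ} (hσ : OnlyEven σ k) {c : DualChain n k}
    (hc : 0 ≤ c) : 0 ≤ dualSubst σ k c := by
  rw [dualSubst_eq_sum]
  exact Finset.sum_nonneg fun F _ => smul_nonneg (hc F) (dualSubst_single_nonneg hσ F)

lemma mem_support_dualSubst {n : ℕ} {σ : Subst n} (hdet : IsUnit (incidence σ).det) {k : ℕ}
    (hσ : OnlyEven σ k) {c : DualChain n k} (hc : 0 ≤ c) (G : (Fin n → ℤ) × Wedge n k) :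
    G ∈ (dualSubst σ k c).support ↔ ∃ F ∈ c.support, Step σ F G := by
  rw [dualSubst_eq_sum, mem_support_sum_of_nonneg fun F _ =>
    smul_nonneg (hc F) (dualSubst_single_nonneg hσ F)]
  refine exists_congr fun F => and_congr_right fun hF => ?_
  rw [← mem_support_dualSubst_single hdet hσ, Finsupp.support_smul_eq (Finsupp.mem_support_iff.1 hF)]

lemma mem_support_dualSubst_pow {n : ℕ} {σ : Subst n} (hdet : IsUnit (incidence σ).det) {k : ℕ}
    (hσ : OnlyEven σ k) (m : ℕ) {c : DualChain n k} (hc : 0 ≤ c) (G : (Fin n → ℤ) × Wedge n k) :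
    G ∈ ((dualSubst σ k ^ m) c).support ↔ ∃ F ∈ c.support, Reach σ m F G := by
  induction m generalizing c with
  | zero => simp [Reach]
  | succ m ih =>
    rw [pow_succ, Module.End.mul_apply, ih (dualSubst_nonneg hσ hc)]
    simp only [mem_support_dualSubst hdet hσ hc, Reach]
    constructor
    · rintro ⟨H, ⟨F, hF, h⟩, h'⟩; exact ⟨F, hF, H, h, h'⟩
    · rintro ⟨F, hF, H, h, h'⟩; exact ⟨H, ⟨F, hF, h⟩, h'⟩

lemma geomDual_pow_comp_poincare {n k m : ℕ} (h : k + m = n) (σ : Subst n) (l : ℕ) :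
    (geomDual h σ ^ l) ∘ₗ poincare h = poincare h ∘ₗ (dualSubst σ k ^ l) := by
  induction l with
  | zero => rfl
  | succ l ih =>
    rw [pow_succ, Module.End.mul_eq_comp, LinearMap.comp_assoc, geomDual_comp_poincare,
      ← LinearMap.comp_assoc, ih, LinearMap.comp_assoc, ← Module.End.mul_eq_comp, ← pow_succ]

/-- The Poincaré map permutes the basis up to signs: the complement determines the type, and then
the shifted position determines the face. -/
lemma mem_support_poincare {n k m : ℕ} (h : k + m = n) (c : DualChain n k)
    (G : (Fin n → ℤ) × Wedge n m) :
    G ∈ (poincare h c).support ↔ ∃ F ∈ c.support, G = (F.1 + F.2.vec, F.2.star h) := by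
  have hstar : ∀ a b : Wedge n k, a.star h = b.star h → a = b := fun a b hab => by
    rw [← Wedge.star_star h ((Nat.add_comm m k).trans h) a, hab, Wedge.star_star]
  have hsgn : ∀ a : Wedge n k, a.sgn ≠ 0 := fun a h0 => by
    have := a.sgn_mul_self; simp [h0] at this
  have hval : ∀ F : (Fin n → ℤ) × Wedge n k,
      poincare h c (F.1 + F.2.vec, F.2.star h) = c F * F.2.sgn := by
    intro F
    rw [poincare, Finsupp.linearCombination_apply, Finsupp.sum, Finsupp.finsetSum_apply]
    rw [Finset.sum_eq_single F]
    · simp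
    · intro F' _ hne
      rw [Finsupp.smul_apply, Finsupp.single_eq_of_ne, smul_zero]
      rintro heq
      rw [Prod.mk.injEq] at heq
      have h2 := hstar _ _ heq.2
      refine hne (Prod.ext ?_ h2.symm)
      have h1 := heq.1
      rw [h2] at h1
      exact (add_right_cancel h1).symm
    · intro hF
      rw [Finsupp.notMem_support_iff.1 hF]; simp
  constructor
  · intro hG
    refine ⟨(G.1 - (G.2.star ((Nat.add_comm m k).trans h)).vec,
      G.2.star ((Nat.add_comm m k).trans h)), ?_, ?_⟩
    · rw [Finsupp.mem_support_iff] at hG ⊢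
      intro h0
      have := hval (G.1 - (G.2.star ((Nat.add_comm m k).trans h)).vec,
        G.2.star ((Nat.add_comm m k).trans h))
      simp only [sub_add_cancel, Wedge.star_star, Prod.mk.eta] at this
      rw [this, h0, zero_mul] at hG
      exact hG rfl
    · simp [Wedge.star_star]
  · rintro ⟨F, hF, rfl⟩
    rw [Finsupp.mem_support_iff, hval]
    exact mul_ne_zero (Finsupp.mem_support_iff.1 hF) (hsgn _)

/-- Conjugation by the Poincaré map turns the iterate into one of `E_k^*(σ)`. The sign of the
starting face is a global factor `±1` and does not affect the support. -/
lemma mem_chainSupport_geomDual_pow {n k m : ℕ} (h : k + m = n) {σ : Subst n}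
    (hdet : IsUnit (incidence σ).det) (hσ : OnlyEven σ k) (l : ℕ)
    (F : (Fin n → ℤ) × Wedge n k) (y : Fin n → ℝ) :
    y ∈ chainSupport ((geomDual h σ ^ l) (Finsupp.single (F.1 + F.2.vec, F.2.star h) 1)) ↔
      ∃ G, Reach σ l F G ∧ y ∈ faceSupport (G.1 + G.2.vec, G.2.star h) := by
  have h1 : (Finsupp.single (F.1 + F.2.vec, F.2.star h) 1 : Chain n m) =
      F.2.sgn • poincare h (Finsupp.single F 1) := by
    simp [poincare, Wedge.sgn_mul_self]
  have hs : F.2.sgn ≠ 0 := fun h0 => by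
    have := F.2.sgn_mul_self; simp [h0] at this
  have h2 : ∀ H : (Fin n → ℤ) × Wedge n m,
      H ∈ ((geomDual h σ ^ l) (Finsupp.single (F.1 + F.2.vec, F.2.star h) 1)).support ↔
      ∃ G, Reach σ l F G ∧ H = (G.1 + G.2.vec, G.2.star h) := by
    intro H
    rw [h1, map_smul, Finsupp.support_smul_eq hs, ← LinearMap.comp_apply,
      geomDual_pow_comp_poincare, LinearMap.comp_apply, mem_support_poincare]
    simp only [mem_support_dualSubst_pow hdet hσ l
      (show (0 : DualChain n k) ≤ Finsupp.single F 1 from Finsupp.single_nonneg.2 zero_le_one)]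
    simp
  simp only [chainSupport, Set.mem_iUnion, exists_prop, h2]
  constructor
  · rintro ⟨H, ⟨G, hG, rfl⟩, hy⟩; exact ⟨G, hG, hy⟩
  · rintro ⟨G, hG, hy⟩; exact ⟨_, ⟨G, hG, rfl⟩, hy⟩

/-! ### Prefixes of substituted infinite words -/

/-- Abelianizations of the non-empty prefixes of `u` that end in the letter `a`. -/
def prefixSet {n : ℕ} (u : ℕ → Fin n) (a : Fin n) : Set (Fin n → ℤ) :=
  {x | ∃ N, u N = a ∧ x = abel ((List.range (N + 1)).map u)}

/-- The image of the prefix of length `m` of `u`. -/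
def imagePrefix {n : ℕ} (τ : Subst n) (u : ℕ → Fin n) (m : ℕ) : List (Fin n) :=
  (List.range m).flatMap fun i => τ (u i)

lemma imagePrefix_succ {n : ℕ} (τ : Subst n) (u : ℕ → Fin n) (m : ℕ) :
    imagePrefix τ u (m + 1) = imagePrefix τ u m ++ τ (u m) := by
  simp [imagePrefix, List.range_succ]

lemma imagePrefix_mono {n : ℕ} (τ : Subst n) (u : ℕ → Fin n) {k l : ℕ} (h : k ≤ l) :
    imagePrefix τ u k <+: imagePrefix τ u l := by
  induction h with
  | refl => exact List.prefix_rfl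
  | step _ ih => exact ih.trans (by rw [imagePrefix_succ]; exact List.prefix_append _ _)

lemma abel_imagePrefix {n : ℕ} (τ : Subst n) (u : ℕ → Fin n) (m : ℕ) :
    abel (imagePrefix τ u m) = (incidence τ).mulVec (abel ((List.range m).map u)) := by
  rw [← abel_flatMap, imagePrefix, List.flatMap_map]

lemma le_length_imagePrefix {n : ℕ} {τ : Subst n} (hτ : ∀ a, τ a ≠ []) (u : ℕ → Fin n) (m : ℕ) :
    m ≤ (imagePrefix τ u m).length := by
  induction m with
  | zero => simp
  | succ m ih =>
    have := List.length_pos_iff.2 (hτ (u m))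
    rw [imagePrefix_succ, List.length_append]
    omega

lemma onInf_eq_getElem {n : ℕ} {τ : Subst n} (hτ : ∀ a, τ a ≠ []) (u : ℕ → Fin n) {m i : ℕ}
    (hi : i < (imagePrefix τ u m).length) : τ.onInf u i = (imagePrefix τ u m)[i] := by
  have h1 : i < (imagePrefix τ u (i + 1)).length := le_length_imagePrefix hτ u (i + 1)
  have h2 : τ.onInf u i = (imagePrefix τ u (i + 1))[i] := List.getD_eq_getElem _ _ h1
  rw [h2]
  rcases le_total (i + 1) m with h | h
  · exact (imagePrefix_mono τ u h).getElem h1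
  · exact ((imagePrefix_mono τ u h).getElem hi).symm

lemma map_onInf_range {n : ℕ} {τ : Subst n} (hτ : ∀ a, τ a ≠ []) (u : ℕ → Fin n) {m N : ℕ}
    (hN : N ≤ (imagePrefix τ u m).length) :
    (List.range N).map (τ.onInf u) = (imagePrefix τ u m).take N := by
  apply List.ext_getElem
  · simpa using hN
  · intro i h1 h2
    simp only [List.length_map, List.length_range] at h1
    simp [onInf_eq_getElem hτ u (h1.trans_le hN)]

/-- The `+ 1` keeps the distinguished letter `b` inside the prefix, so what is missing from the
image of `u_0 ⋯ u_m` is exactly the suffix `r`. -/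
lemma onInf_at {n : ℕ} {τ : Subst n} (hτ : ∀ a, τ a ≠ []) (u : ℕ → Fin n) {m : ℕ} {b : Fin n}
    {p r : List (Fin n)} (h : τ (u m) = p ++ b :: r) :
    τ.onInf u ((imagePrefix τ u m).length + p.length) = b ∧
    abel ((List.range ((imagePrefix τ u m).length + p.length + 1)).map (τ.onInf u)) =
      (incidence τ).mulVec (abel ((List.range (m + 1)).map u)) - abel r := by
  have hW : imagePrefix τ u (m + 1) = (imagePrefix τ u m ++ p ++ [b]) ++ r := by
    rw [imagePrefix_succ, h]; simp
  have hlen : (imagePrefix τ u m ++ p ++ [b]).length =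
    (imagePrefix τ u m).length + p.length + 1 := by simp; omega
  have hle : (imagePrefix τ u m).length + p.length + 1 ≤ (imagePrefix τ u (m + 1)).length := by
    rw [hW, List.length_append, hlen]; omega
  constructor
  · rw [onInf_eq_getElem hτ u (Nat.lt_of_succ_le hle)]
    simp only [hW]
    rw [List.getElem_append_left (by rw [hlen]; omega)]
    rw [List.getElem_append_right (by simp)]
    simp
  · rw [map_onInf_range hτ u hle, ← abel_imagePrefix, hW, List.take_left' hlen, abel_append _ r,
      add_sub_cancel_right]

lemma exists_position {n : ℕ} {τ : Subst n} (hτ : ∀ a, τ a ≠ []) (u : ℕ → Fin n) (N : ℕ) :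
    ∃ m b p r, τ (u m) = p ++ b :: r ∧ N = (imagePrefix τ u m).length + p.length := by
  obtain ⟨m, hm1, hm2⟩ : ∃ m, (imagePrefix τ u m).length ≤ N ∧
      N < (imagePrefix τ u (m + 1)).length := by
    by_contra! hcon
    have : ∀ m, (imagePrefix τ u m).length ≤ N := by
      intro m
      induction m with
      | zero => simp [imagePrefix]
      | succ m ih => exact hcon m ih
    exact absurd (this (N + 1)) (by have := le_length_imagePrefix hτ u (N + 1); omega)
  rw [imagePrefix_succ, List.length_append] at hm2
  have hj : N - (imagePrefix τ u m).length < (τ (u m)).length := by omega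
  refine ⟨m, (τ (u m))[N - (imagePrefix τ u m).length],
    (τ (u m)).take (N - (imagePrefix τ u m).length),
    (τ (u m)).drop (N - (imagePrefix τ u m).length + 1), ?_, ?_⟩
  · rw [List.cons_getElem_drop_succ, List.take_append_drop]
  · rw [List.length_take]; omega

/-- Each position of `τ(u)` lies in the image of a unique letter `u_m`. For `τ(u) = u` this is the
self-similarity of the prefix sets. -/
lemma mem_prefixSet_onInf {n : ℕ} {τ : Subst n} (hτ : ∀ a, τ a ≠ []) (u : ℕ → Fin n) (a : Fin n)
    (x : Fin n → ℤ) :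
    x ∈ prefixSet (τ.onInf u) a ↔ ∃ c s, Occ τ c a s ∧ ∃ y ∈ prefixSet u c,
      x = (incidence τ).mulVec y - s := by
  constructor
  · rintro ⟨N, rfl, rfl⟩
    obtain ⟨m, b, p, r, h, rfl⟩ := exists_position hτ u N
    obtain ⟨h1, h2⟩ := onInf_at hτ u h
    exact ⟨u m, _, ⟨p, r, by rw [h1]; exact h, rfl⟩, _, ⟨m, rfl, rfl⟩, h2⟩
  · rintro ⟨c, s, ⟨p, r, h, rfl⟩, y, ⟨m, rfl, rfl⟩, rfl⟩
    obtain ⟨h1, h2⟩ := onInf_at hτ u h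
    exact ⟨_, h1, h2.symm⟩

/-! ### The successors of a type for `σ_t` -/

lemma sigma_ne_nil (t : ℕ) (a : Fin 5) : sigma t a ≠ [] := by
  fin_cases a <;> simp [sigma]

lemma chi_ne_nil (a : Fin 5) : chi a ≠ [] := by
  fin_cases a <;> simp [chi]

lemma abel_replicate {n : ℕ} (j : ℕ) (a : Fin n) :
    abel (List.replicate j a) = (j : ℤ) • Pi.single a 1 := by
  induction j with
  | zero => simp [abel_nil]
  | succ j ih => rw [List.replicate_succ, abel_cons, ih]; push_cast; rw [add_smul, one_smul, add_comm]

lemma occ_singleton_iff {n : ℕ} {σ : Subst n} {c a b : Fin n} {s : Fin n → ℤ}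
    (h : σ c = [b]) : Occ σ c a s ↔ a = b ∧ s = 0 := by
  rw [Occ, h]
  constructor
  · rintro ⟨p, r, h, rfl⟩
    rcases p with _ | ⟨_, p⟩
    · simp only [List.nil_append, List.cons.injEq] at h
      obtain ⟨h1, h2⟩ := h
      exact ⟨h1.symm, by rw [← h2, abel_nil]⟩
    · simp at h
  · rintro ⟨rfl, rfl⟩
    exact ⟨[], [], rfl, abel_nil.symm⟩

lemma replicate_append_eq_iff {α : Type*} {x y a : α} (m : ℕ) {p r : List α} :
    List.replicate m x ++ [y] = p ++ a :: r ↔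
      (∃ j < m, p = List.replicate (m - 1 - j) x ∧ a = x ∧ r = List.replicate j x ++ [y]) ∨
      (p = List.replicate m x ∧ a = y ∧ r = []) := by
  induction m generalizing p with
  | zero =>
    rcases p with _ | ⟨b, p⟩
    · simp [eq_comm]
    · simp
  | succ m ih =>
    rcases p with _ | ⟨b, p⟩
    · simp only [List.replicate_succ, List.cons_append, List.nil_append, List.cons.injEq]
      constructor
      · rintro ⟨rfl, rfl⟩
        exact Or.inl ⟨m, by omega, by simp, rfl, rfl⟩
      · rintro (⟨j, hj, h1, rfl, rfl⟩ | ⟨h1, -⟩)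
        · have : j = m := by
            have := congrArg List.length h1
            simp at this; omega
          subst this; exact ⟨rfl, rfl⟩
        · simp at h1
    · simp only [List.replicate_succ, List.cons_append, List.cons.injEq, ih]
      constructor
      · rintro ⟨rfl, (⟨j, hj, rfl, rfl, rfl⟩ | ⟨rfl, rfl, rfl⟩)⟩
        · refine Or.inl ⟨j, by omega, ?_, rfl, rfl⟩
          rw [← List.replicate_succ]; congr 1; omega
        · exact Or.inr ⟨⟨rfl, rfl⟩, rfl, rfl⟩
      · rintro (⟨j, hj, h1, rfl, rfl⟩ | ⟨⟨rfl, rfl⟩, rfl, rfl⟩)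
        · have h2 : m + 1 - 1 - j = (m - 1 - j) + 1 := by
            have := congrArg List.length h1
            simp at this; omega
          rw [h2, List.replicate_succ, List.cons.injEq] at h1
          obtain ⟨rfl, rfl⟩ := h1
          exact ⟨rfl, Or.inl ⟨j, by omega, rfl, rfl, rfl⟩⟩
        · exact ⟨rfl, Or.inr ⟨rfl, rfl, rfl⟩⟩

lemma occ_replicate_append_iff {n : ℕ} {σ : Subst n} {c a x y : Fin n} {s : Fin n → ℤ} {m : ℕ}
    (h : σ c = List.replicate m x ++ [y]) :
    Occ σ c a s ↔ (a = x ∧ ∃ j < m, s = (j : ℤ) • Pi.single x 1 + Pi.single y 1) ∨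
      (a = y ∧ s = 0) := by
  rw [Occ, h]
  simp only [replicate_append_eq_iff]
  have habel : ∀ j, abel (List.replicate j x ++ [y]) =
      (j : ℤ) • Pi.single x 1 + Pi.single y 1 := fun j => by
    rw [abel_append, abel_replicate, abel_cons, abel_nil, add_zero]
  constructor
  · rintro ⟨p, r, ⟨j, hj, rfl, rfl, rfl⟩ | ⟨rfl, rfl, rfl⟩, rfl⟩
    · exact Or.inl ⟨rfl, j, hj, habel j⟩
    · exact Or.inr ⟨rfl, abel_nil⟩
  · rintro (⟨rfl, j, hj, rfl⟩ | ⟨rfl, rfl⟩)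
    · exact ⟨_, _, Or.inl ⟨j, hj, rfl, rfl, rfl⟩, (habel j).symm⟩
    · exact ⟨_, _, Or.inr ⟨rfl, rfl, rfl⟩, abel_nil.symm⟩

lemma occ_sigma_iff {t : ℕ} {c a : Fin 5} {s : Fin 5 → ℤ} :
    Occ (sigma t) c a s ↔
      (c = 0 ∧ a = 0 ∧ ∃ j ≤ t, s = (j : ℤ) • Pi.single 0 1 + Pi.single 1 1) ∨
      (c = 0 ∧ a = 1 ∧ s = 0) ∨ (c = 1 ∧ a = 2 ∧ s = 0) ∨ (c = 2 ∧ a = 3 ∧ s = 0) ∨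
      (c = 3 ∧ a = 0 ∧ ∃ j < t, s = (j : ℤ) • Pi.single 0 1 + Pi.single 4 1) ∨
      (c = 3 ∧ a = 4 ∧ s = 0) ∨ (c = 4 ∧ a = 0 ∧ s = 0) := by
  have h0 : ∀ a, Occ (sigma t) 0 a s ↔ _ := fun a =>
    occ_replicate_append_iff (show sigma t 0 = List.replicate (t + 1) 0 ++ [1] from rfl)
  have h1 : ∀ a, Occ (sigma t) 1 a s ↔ _ := fun a =>
    occ_singleton_iff (show sigma t 1 = [2] from rfl)
  have h2 : ∀ a, Occ (sigma t) 2 a s ↔ _ := fun a =>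
    occ_singleton_iff (show sigma t 2 = [3] from rfl)
  have h3 : ∀ a, Occ (sigma t) 3 a s ↔ _ := fun a =>
    occ_replicate_append_iff (show sigma t 3 = List.replicate t 0 ++ [4] from rfl)
  have h4 : ∀ a, Occ (sigma t) 4 a s ↔ _ := fun a =>
    occ_singleton_iff (show sigma t 4 = [0] from rfl)
  fin_cases c <;> simp [h0, h1, h2, h3, h4]

lemma occ_sigma_zero {t : ℕ} {c : Fin 5} {s : Fin 5 → ℤ} :
    Occ (sigma t) c 0 s ↔
      (c = 0 ∧ ∃ j ≤ t, s = (j : ℤ) • Pi.single 0 1 + Pi.single 1 1) ∨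
      (c = 3 ∧ ∃ j < t, s = (j : ℤ) • Pi.single 0 1 + Pi.single 4 1) ∨ (c = 4 ∧ s = 0) := by
  rw [occ_sigma_iff]; simp

lemma occ_sigma_one {t : ℕ} {c : Fin 5} {s : Fin 5 → ℤ} :
    Occ (sigma t) c 1 s ↔ c = 0 ∧ s = 0 := by
  rw [occ_sigma_iff]; simp

lemma occ_sigma_two {t : ℕ} {c : Fin 5} {s : Fin 5 → ℤ} :
    Occ (sigma t) c 2 s ↔ c = 1 ∧ s = 0 := by
  rw [occ_sigma_iff]; simp

lemma occ_sigma_three {t : ℕ} {c : Fin 5} {s : Fin 5 → ℤ} :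
    Occ (sigma t) c 3 s ↔ c = 2 ∧ s = 0 := by
  rw [occ_sigma_iff]; simp

lemma occ_sigma_four {t : ℕ} {c : Fin 5} {s : Fin 5 → ℤ} :
    Occ (sigma t) c 4 s ↔ c = 3 ∧ s = 0 := by
  rw [occ_sigma_iff]; simp

lemma Wedge.letter_strictMono {n k : ℕ} (a : Wedge n k) : StrictMono a.letter :=
  (a.1.orderEmbOfFin a.2).strictMono

lemma Wedge.image_letter {n k : ℕ} (a : Wedge n k) : Finset.univ.image a.letter = a.1 :=
  a.1.image_orderEmbOfFin_univ a.2

/-- In an occurrence of `a` in `σ(b)`, either `a = b + 1`, or `a = 0` and `b ∈ {0, 3, 4}`. Non-zero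
letters thus keep the order, and only the smallest letter of the type can be 0. The one
transposition not excluded by this order exchanges the first two places; it needs `b_1 = 3` and `b_2
= 4`, but 4 produces only the letter 0. -/
lemma onlyEven_sigma (t : ℕ) : OnlyEven (sigma t) 3 := by
  intro a b τ h
  have ha1 : (a.letter 0).val < (a.letter 1).val := a.letter_strictMono (by decide)
  have ha2 : (a.letter 1).val < (a.letter 2).val := a.letter_strictMono (by decide)
  have hb1 : (b.letter 0).val < (b.letter 1).val := b.letter_strictMono (by decide)
  have hb2 : (b.letter 1).val < (b.letter 2).val := b.letter_strictMono (by decide)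
  have ha3 := (a.letter 2).isLt
  have hb3 := (b.letter 2).isLt
  have key : ∀ i, ((a.letter (τ i)).val = 0 ∧ ((b.letter i).val = 0 ∨ (b.letter i).val = 3 ∨
      (b.letter i).val = 4)) ∨ (a.letter (τ i)).val = (b.letter i).val + 1 := by
    intro i
    obtain ⟨s, hs⟩ := h i
    generalize a.letter (τ i) = x at hs
    generalize b.letter i = y at hs
    rcases occ_sigma_iff.1 hs with ⟨rfl, rfl, -⟩ | ⟨rfl, rfl, -⟩ | ⟨rfl, rfl, -⟩ | ⟨rfl, rfl, -⟩ |
      ⟨rfl, rfl, -⟩ | ⟨rfl, rfl, -⟩ | ⟨rfl, rfl, -⟩ <;> simp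
  have k0 := key 0
  have k1 := key 1
  have k2 := key 2
  have hτ : ∀ τ : Equiv.Perm (Fin 3), Equiv.Perm.sign τ = 1 ∨ (τ 0 = 1 ∧ τ 1 = 0 ∧ τ 2 = 2) ∨
      (τ 0 = 0 ∧ τ 1 = 2 ∧ τ 2 = 1) ∨ (τ 0 = 2 ∧ τ 1 = 1 ∧ τ 2 = 0) := by decide
  rcases hτ τ with h | ⟨h0, h1, h2⟩ | ⟨h0, h1, h2⟩ | ⟨h0, h1, h2⟩
  · exact h
  all_goals
    rw [h0] at k0; rw [h1] at k1; rw [h2] at k2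
    omega

lemma Wedge.letter_eq {a : Wedge 5 3} {a₀ a₁ a₂ : Fin 5} (h01 : a₀ < a₁) (h12 : a₁ < a₂)
    (h : a.1 = {a₀, a₁, a₂}) : a.letter = ![a₀, a₁, a₂] := by
  have hmono : StrictMono ![a₀, a₁, a₂] := by
    intro i j hij
    fin_cases i <;> fin_cases j <;> first | exact absurd hij (by decide) | simp [h01, h12, h01.trans h12]
  refine (Finset.orderEmbOfFin_unique a.2 (fun i => ?_) hmono).symm
  rw [h]; fin_cases i <;> simp

/-- Replaces the sorted enumeration of `b` and the permutation by independent choices of a letter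
producing each `a_i`. The permutation is recovered by sorting the chosen letters, which are distinct
because `b` has three elements. -/
lemma succ_iff_of_eq {t : ℕ} {a b : Wedge 5 3} {a₀ a₁ a₂ : Fin 5} {v : Fin 5 → ℤ}
    (h01 : a₀ < a₁) (h12 : a₁ < a₂) (h : a.1 = {a₀, a₁, a₂}) :
    Succ (sigma t) a b v ↔ ∃ b₀ s₀, Occ (sigma t) b₀ a₀ s₀ ∧ ∃ b₁ s₁, Occ (sigma t) b₁ a₁ s₁ ∧
      ∃ b₂ s₂, Occ (sigma t) b₂ a₂ s₂ ∧ b.1 = {b₀, b₁, b₂} ∧ v = s₀ + s₁ + s₂ := by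
  have hl := Wedge.letter_eq h01 h12 h
  constructor
  · rintro ⟨τ, s, hs, rfl⟩
    have hs' : ∀ i, Occ (sigma t) (b.letter (τ.symm i)) (a.letter i) (s (τ.symm i)) := fun i => by
      simpa using hs (τ.symm i)
    rw [hl] at hs'
    refine ⟨_, _, hs' 0, _, _, hs' 1, _, _, hs' 2, ?_, ?_⟩
    · rw [← b.image_letter, ← Finset.image_univ_equiv τ.symm, Finset.image_image]
      ext x
      simp [Fin.exists_fin_succ, eq_comm]
    · rw [← Equiv.sum_comp τ.symm, Fin.sum_univ_three]
  · rintro ⟨b₀, s₀, h₀, b₁, s₁, h₁, b₂, s₂, h₂, hb, rfl⟩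
    let f : Fin 3 → Fin 5 := ![b₀, b₁, b₂]
    have hf : ∀ i, ∃ j, b.letter j = f i := by
      intro i
      have : f i ∈ b.1 := by rw [hb]; fin_cases i <;> simp [f]
      rw [← b.image_letter] at this
      simpa using this
    choose g hg using hf
    have hinj : Function.Injective g := by
      have hfi : Function.Injective f := by
        have hc : (Finset.univ.image f).card = 3 := by
          refine Eq.trans (congrArg Finset.card ?_) b.2
          rw [hb]
          ext x; simp [f, Fin.exists_fin_succ, eq_comm]
        rw [← Set.injOn_univ, ← Finset.coe_univ, ← Finset.card_image_iff, hc]; rfl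
      intro i j hij
      apply hfi
      rw [← hg, ← hg, hij]
    let τ := Equiv.ofBijective g (Finite.injective_iff_bijective.1 hinj)
    refine ⟨τ.symm, fun i => ![s₀, s₁, s₂] (τ.symm i), fun i => ?_, ?_⟩
    · obtain ⟨j, rfl⟩ := τ.surjective i
      have : b.letter (τ j) = f j := hg j
      simp only [this, Equiv.symm_apply_apply, hl]
      fin_cases j
      · exact h₀
      · exact h₁
      · exact h₂
    · rw [Equiv.sum_comp τ.symm, Fin.sum_univ_three]; rfl

/-! ### Set equations for the subtiles -/

/-- A family of sets indexed by the letters that satisfies the set equations of the subtiles of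
`σ_t`, for a linear map `M` and vectors `e i` on which `M` acts as the incidence matrix, modulo
`e 0 = e 2 + e 3` and `e 4 = e 1 + e 2`. -/
structure IsTileFamily {V : Type*} [AddCommGroup V] (t : ℕ) (M : V →+ V) (e : Fin 5 → V)
    (F : Fin 5 → Set V) : Prop where
  e_zero : e 0 = e 2 + e 3
  e_four : e 4 = e 1 + e 2
  map_one : M (e 1) = e 2
  map_two : M (e 2) = e 3
  map_three : M (e 3) = (t : ℤ) • e 0 + e 4
  mem_zero : ∀ x, x ∈ F 0 ↔ (∃ j ≤ t, ∃ y ∈ F 0, x = M y - ((j : ℤ) • e 0 + e 1)) ∨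
    (∃ j < t, ∃ y ∈ F 3, x = M y - ((j : ℤ) • e 0 + e 4)) ∨ ∃ y ∈ F 4, x = M y
  mem_one : ∀ x, x ∈ F 1 ↔ ∃ y ∈ F 0, x = M y
  mem_two : ∀ x, x ∈ F 2 ↔ ∃ y ∈ F 1, x = M y
  mem_three : ∀ x, x ∈ F 3 ↔ ∃ y ∈ F 2, x = M y
  mem_four : ∀ x, x ∈ F 4 ↔ ∃ y ∈ F 3, x = M y

/-- The union of subtiles attached to the type `{0, 1, 2}`. -/
def tile012 {V : Type*} [AddCommGroup V] (t : ℕ) (M : V →+ V) (e : Fin 5 → V)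
    (F : Fin 5 → Set V) : Set V :=
  {x | x ∈ F 2 ∨ (∃ j < t, ∃ y ∈ F 0, x = M y - (((j + 1 : ℕ) : ℤ) • e 0 + e 1)) ∨
    (∃ j < t, ∃ y ∈ F 3, x = M y - ((j : ℤ) • e 0 + e 4)) ∨ ∃ y ∈ F 4, x = M y}

/-- The sets attached to the types `a ∈ 𝒪_3` that solve the set equations of `E_3^*(σ_t)`. -/
def dualTile {V : Type*} [AddCommGroup V] (t : ℕ) (M : V →+ V) (e : Fin 5 → V)
    (F : Fin 5 → Set V) (a : Finset (Fin 5)) : Set V :=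
  if a = {0, 1, 4} then {x | x ∈ F 1 ∨ x ∈ F 4}
  else if a = {0, 3, 4} then {x | x ∈ F 3 ∨ x ∈ F 0}
  else if a = {0, 2, 4} then {x | x ∈ F 2 ∨ x + e 3 ∈ F 0 ∨ x + e 1 ∈ F 4}
  else if a = {0, 2, 3} then {x | x ∈ F 0 ∨ x + e 1 ∈ F 3}
  else if a = {0, 1, 3} then {x | x + e 2 ∈ F 0 ∨ x ∈ F 3}
  else if a = {0, 1, 2} then tile012 t M e F
  -- Each letter other than 0 occurs in the image of exactly one letter, with empty suffix. The
  -- types without 0 thus have a single successor, and their sets are forced to be images under `M`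
  -- of sets already given.
  else if a = {1, 2, 3} then {x | ∃ y ∈ tile012 t M e F, x = M y}
  else if a = {2, 3, 4} then {x | ∃ y ∈ tile012 t M e F, x = M (M y)}
  else if a = {1, 2, 4} then {x | ∃ y, (y + e 2 ∈ F 0 ∨ y ∈ F 3) ∧ x = M y}
  else {x | ∃ y, (y ∈ F 0 ∨ y + e 1 ∈ F 3) ∧ x = M y}

namespace IsTileFamily

variable {V : Type*} [AddCommGroup V] {t : ℕ} {M : V →+ V} {e : Fin 5 → V} {F : Fin 5 → Set V}

/-- Isolates the piece `j = 0`, the one that `tile012` leaves out. -/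
lemma mem_zero' (h : IsTileFamily t M e F) (x : V) :
    x ∈ F 0 ↔ (∃ y ∈ F 0, x = M y - e 1) ∨
      (∃ j < t, ∃ y ∈ F 0, x = M y - (((j + 1 : ℕ) : ℤ) • e 0 + e 1)) ∨
      (∃ j < t, ∃ y ∈ F 3, x = M y - ((j : ℤ) • e 0 + e 4)) ∨ ∃ y ∈ F 4, x = M y := by
  rw [h.mem_zero, ← or_assoc (a := ∃ y ∈ F 0, x = M y - e 1)]
  refine or_congr_left (b := _ ∨ _) ⟨?_, ?_⟩
  · rintro ⟨_ | j, hj, y, hy, rfl⟩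
    · exact Or.inl ⟨y, hy, by simp⟩
    · exact Or.inr ⟨j, hj, y, hy, rfl⟩
  · rintro (⟨y, hy, rfl⟩ | ⟨j, hj, y, hy, rfl⟩)
    · exact ⟨0, t.zero_le, y, hy, by simp⟩
    · exact ⟨j + 1, hj, y, hy, rfl⟩

/-- `tile012` is `F 2` together with all pieces of `F 0` except `M F 0 - e 1`. The pieces may
overlap, so only this identity of unions is available, and it is what the other equations use. -/
lemma mem_zero_iff_tile012 (h : IsTileFamily t M e F) (x : V) :
    x ∈ F 0 ∨ x ∈ F 2 ↔ (∃ y ∈ F 0, x = M y - e 1) ∨ x ∈ tile012 t M e F := by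
  rw [h.mem_zero', tile012, Set.mem_ofPred_eq, or_assoc, or_comm (b := x ∈ F 2)]

/-- This is `M²` applied to `mem_zero_iff_tile012`: `M² F 0 = F 2`, `M² F 2 = F 4`, and `M²(M F 0 -
e 1) = F 3 - e 3`. -/
lemma mem_two_or_four (h : IsTileFamily t M e F) (x : V) :
    x ∈ F 2 ∨ x ∈ F 4 ↔ x + e 3 ∈ F 3 ∨ ∃ y ∈ tile012 t M e F, x = M (M y) := by
  have hM : M (M (e 1)) = e 3 := by rw [h.map_one, h.map_two]
  constructor
  · intro hx
    obtain ⟨y, hy, rfl⟩ : ∃ y, (y ∈ F 0 ∨ y ∈ F 2) ∧ x = M (M y) := by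
      rcases hx with hx | hx
      · obtain ⟨y, hy, rfl⟩ := (h.mem_two _).1 hx
        obtain ⟨z, hz, rfl⟩ := (h.mem_one _).1 hy
        exact ⟨z, Or.inl hz, rfl⟩
      · obtain ⟨y, hy, rfl⟩ := (h.mem_four _).1 hx
        obtain ⟨z, hz, rfl⟩ := (h.mem_three _).1 hy
        exact ⟨z, Or.inr hz, rfl⟩
    rcases (h.mem_zero_iff_tile012 y).1 hy with ⟨z, hz, rfl⟩ | hy
    · refine Or.inl ?_
      rw [map_sub, map_sub, hM, sub_add_cancel]
      exact (h.mem_three _).2 ⟨_, (h.mem_two _).2 ⟨_, (h.mem_one _).2 ⟨z, hz, rfl⟩, rfl⟩, rfl⟩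
    · exact Or.inr ⟨y, hy, rfl⟩
  · intro hx
    obtain ⟨y, hy, rfl⟩ : ∃ y, (y ∈ F 0 ∨ y ∈ F 2) ∧ x = M (M y) := by
      rcases hx with hx | ⟨y, hy, rfl⟩
      · obtain ⟨y, hy, hy'⟩ := (h.mem_three _).1 hx
        obtain ⟨z, hz, rfl⟩ := (h.mem_two _).1 hy
        obtain ⟨w, hw, rfl⟩ := (h.mem_one _).1 hz
        refine ⟨M w - e 1, (h.mem_zero_iff_tile012 _).2 (Or.inl ⟨w, hw, rfl⟩), ?_⟩
        rw [map_sub, map_sub, hM, ← hy', add_sub_cancel_right]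
      · exact ⟨y, (h.mem_zero_iff_tile012 _).2 (Or.inr hy), rfl⟩
    rcases hy with hy | hy
    · exact Or.inl ((h.mem_two _).2 ⟨_, (h.mem_one _).2 ⟨_, hy, rfl⟩, rfl⟩)
    · exact Or.inr ((h.mem_four _).2 ⟨_, (h.mem_three _).2 ⟨_, hy, rfl⟩, rfl⟩)

lemma tile034 (h : IsTileFamily t M e F) (x : V) :
    x ∈ F 3 ∨ x ∈ F 0 ↔
      (∃ j ≤ t, ∃ y, (y ∈ F 0 ∨ y + e 1 ∈ F 3) ∧ x = M y - ((j : ℤ) • e 0 + e 1)) ∨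
      ∃ y, (∃ z ∈ tile012 t M e F, y = M (M z)) ∧ x = M y := by
  have h4 := h.e_four
  have h1 := h.map_one
  have h3 := h.map_three
  constructor
  · have key : ∀ y, (y ∈ F 2 ∨ y ∈ F 4) → x = M y →
        (∃ j ≤ t, ∃ y, (y ∈ F 0 ∨ y + e 1 ∈ F 3) ∧ x = M y - ((j : ℤ) • e 0 + e 1)) ∨
        ∃ y, (∃ z ∈ tile012 t M e F, y = M (M z)) ∧ x = M y := by
      rintro y hy rfl
      rcases (h.mem_two_or_four y).1 hy with hy | hy
      · refine Or.inl ⟨t, le_rfl, y + e 3 - e 1, Or.inr (by simpa using hy), ?_⟩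
        rw [map_sub, map_add]
        linear_combination (norm := module) h1 - h3 - h4
      · exact Or.inr ⟨y, hy, rfl⟩
    rintro (hx | hx)
    · obtain ⟨y, hy, hxy⟩ := (h.mem_three _).1 hx
      exact key y (Or.inl hy) hxy
    · rcases (h.mem_zero _).1 hx with ⟨j, hj, y, hy, hxy⟩ | ⟨j, hj, y, hy, hxy⟩ | ⟨y, hy, hxy⟩
      · exact Or.inl ⟨j, hj, y, Or.inl hy, hxy⟩
      · refine Or.inl ⟨j, hj.le, y - e 1, Or.inr (by simpa using hy), ?_⟩
        rw [hxy, map_sub]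
        linear_combination (norm := module) h1 - h4
      · exact key y (Or.inr hy) hxy
  · have key : ∀ y, (y ∈ F 2 ∨ y ∈ F 4) → x = M y → x ∈ F 3 ∨ x ∈ F 0 := by
      rintro y (hy | hy) rfl
      · exact Or.inl ((h.mem_three _).2 ⟨y, hy, rfl⟩)
      · exact Or.inr ((h.mem_zero _).2 (Or.inr (Or.inr ⟨y, hy, rfl⟩)))
    rintro (⟨j, hj, y, hy | hy, hxy⟩ | ⟨y, hy, hxy⟩)
    · exact Or.inr ((h.mem_zero _).2 (Or.inl ⟨j, hj, y, hy, hxy⟩))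
    · rcases hj.lt_or_eq with hj | rfl
      · refine Or.inr ((h.mem_zero _).2 (Or.inr (Or.inl ⟨j, hj, _, hy, ?_⟩)))
        rw [hxy, map_add]
        linear_combination (norm := module) h4 - h1
      · refine key (y + e 1 - e 3) ((h.mem_two_or_four _).2 (Or.inl (by simpa using hy))) ?_
        rw [hxy, map_sub, map_add]
        linear_combination (norm := module) h3 + h4 - h1
    · exact key y ((h.mem_two_or_four _).2 (Or.inr hy)) hxy

lemma tile014 (h : IsTileFamily t M e F) (x : V) :
    x ∈ F 1 ∨ x ∈ F 4 ↔ ∃ y, (y ∈ F 3 ∨ y ∈ F 0) ∧ x = M y := by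
  rw [h.mem_one, h.mem_four]
  constructor
  · rintro (⟨y, hy, rfl⟩ | ⟨y, hy, rfl⟩)
    exacts [⟨y, Or.inr hy, rfl⟩, ⟨y, Or.inl hy, rfl⟩]
  · rintro ⟨y, hy | hy, rfl⟩
    exacts [Or.inr ⟨y, hy, rfl⟩, Or.inl ⟨y, hy, rfl⟩]

/-- The index shift between `j` and `j + 1` comes from `e_4 + e_3 = e_0 + e_1`, which combines both
relations. -/
lemma tile024 (h : IsTileFamily t M e F) (x : V) :
    x ∈ F 2 ∨ x + e 3 ∈ F 0 ∨ x + e 1 ∈ F 4 ↔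
      (∃ j ≤ t, ∃ y, (y + e 2 ∈ F 0 ∨ y ∈ F 3) ∧ x = M y - ((j : ℤ) • e 0 + e 1)) ∨
      ∃ y, (∃ z, (z ∈ F 0 ∨ z + e 1 ∈ F 3) ∧ y = M z) ∧ x = M y := by
  have h0 := h.e_zero
  have h4 := h.e_four
  have h1 := h.map_one
  have h2 := h.map_two
  constructor
  · rintro (hx | hx | hx)
    · obtain ⟨y, hy, hxy⟩ := (h.mem_two _).1 hx
      obtain ⟨z, hz, hyz⟩ := (h.mem_one _).1 hy
      exact Or.inr ⟨y, ⟨z, Or.inl hz, hyz⟩, hxy⟩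
    · rcases (h.mem_zero _).1 hx with ⟨j, hj, y, hy, hxy⟩ | ⟨j, hj, y, hy, hxy⟩ | ⟨y, hy, hxy⟩
      · refine Or.inl ⟨j, hj, y - e 2, Or.inl (by simpa using hy), ?_⟩
        rw [map_sub]
        linear_combination (norm := module) hxy + h2
      · refine Or.inl ⟨j + 1, hj, y, Or.inr hy, ?_⟩
        push_cast
        linear_combination (norm := module) hxy - h4 + h0
      · obtain ⟨z, hz, hyz⟩ := (h.mem_four _).1 hy
        refine Or.inr ⟨y - e 2, ⟨z - e 1, Or.inr (by simpa using hz), ?_⟩, ?_⟩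
        · rw [map_sub]
          linear_combination (norm := module) hyz + h1
        · rw [map_sub]
          linear_combination (norm := module) hxy + h2
    · obtain ⟨y, hy, hxy⟩ := (h.mem_four _).1 hx
      refine Or.inl ⟨0, t.zero_le, y, Or.inr hy, ?_⟩
      push_cast
      linear_combination (norm := module) hxy
  · rintro (⟨j, hj, y, hy | hy, hxy⟩ | ⟨y, ⟨z, hz | hz, hyz⟩, hxy⟩)
    · refine Or.inr (Or.inl ((h.mem_zero _).2 (Or.inl ⟨j, hj, _, hy, ?_⟩)))
      rw [map_add]
      linear_combination (norm := module) hxy - h2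
    · rcases j with _ | j
      · refine Or.inr (Or.inr ((h.mem_four _).2 ⟨y, hy, ?_⟩))
        push_cast at hxy
        linear_combination (norm := module) hxy
      · refine Or.inr (Or.inl ((h.mem_zero _).2 (Or.inr (Or.inl ⟨j, hj, y, hy, ?_⟩))))
        push_cast at hxy
        linear_combination (norm := module) hxy + h4 - h0
    · exact Or.inl ((h.mem_two _).2 ⟨y, (h.mem_one _).2 ⟨z, hz, hyz⟩, hxy⟩)
    · refine Or.inr (Or.inl ((h.mem_zero _).2 (Or.inr (Or.inr
        ⟨_, (h.mem_four _).2 ⟨_, hz, rfl⟩, ?_⟩))))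
      rw [map_add, map_add, h1, h2, ← hyz, hxy]

lemma tile013 (h : IsTileFamily t M e F) (x : V) :
    x + e 2 ∈ F 0 ∨ x ∈ F 3 ↔
      (∃ j < t, ∃ y, (y ∈ F 0 ∨ y + e 1 ∈ F 3) ∧ x = M y - ((j : ℤ) • e 0 + e 4)) ∨
      ∃ y, (y ∈ F 2 ∨ y + e 3 ∈ F 0 ∨ y + e 1 ∈ F 4) ∧ x = M y := by
  have h4 := h.e_four
  have h1 := h.map_one
  have h3 := h.map_three
  constructor
  · rintro (hx | hx)
    · rcases (h.mem_zero _).1 hx with ⟨j, hj, y, hy, hxy⟩ | ⟨j, hj, y, hy, hxy⟩ | ⟨y, hy, hxy⟩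
      · rcases hj.lt_or_eq with hj | rfl
        · refine Or.inl ⟨j, hj, y, Or.inl hy, ?_⟩
          linear_combination (norm := module) hxy + h4
        · refine Or.inr ⟨y - e 3, Or.inr (Or.inl (by simpa using hy)), ?_⟩
          rw [map_sub]
          linear_combination (norm := module) hxy + h3 + h4
      · refine Or.inl ⟨j, hj, y - e 1, Or.inr (by simpa using hy), ?_⟩
        rw [map_sub]
        linear_combination (norm := module) hxy + h1
      · refine Or.inr ⟨y - e 1, Or.inr (Or.inr (by simpa using hy)), ?_⟩
        rw [map_sub]
        linear_combination (norm := module) hxy + h1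
    · obtain ⟨y, hy, hxy⟩ := (h.mem_three _).1 hx
      exact Or.inr ⟨y, Or.inl hy, hxy⟩
  · rintro (⟨j, hj, y, hy | hy, hxy⟩ | ⟨y, hy | hy | hy, hxy⟩)
    · refine Or.inl ((h.mem_zero _).2 (Or.inl ⟨j, hj.le, y, hy, ?_⟩))
      linear_combination (norm := module) hxy - h4
    · refine Or.inl ((h.mem_zero _).2 (Or.inr (Or.inl ⟨j, hj, _, hy, ?_⟩)))
      rw [map_add]
      linear_combination (norm := module) hxy - h1
    · exact Or.inr ((h.mem_three _).2 ⟨y, hy, hxy⟩)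
    · refine Or.inl ((h.mem_zero _).2 (Or.inl ⟨t, le_rfl, _, hy, ?_⟩))
      rw [map_add]
      linear_combination (norm := module) hxy - h3 - h4
    · refine Or.inl ((h.mem_zero _).2 (Or.inr (Or.inr ⟨_, hy, ?_⟩)))
      rw [map_add]
      linear_combination (norm := module) hxy - h1

lemma mem_tile012 (h : IsTileFamily t M e F) (x : V) :
    x ∈ tile012 t M e F ↔
      (∃ j < t, ∃ y, (y + e 2 ∈ F 0 ∨ y ∈ F 3) ∧ x = M y - ((j : ℤ) • e 0 + e 4)) ∨
      ∃ y, (y ∈ F 1 ∨ y ∈ F 4) ∧ x = M y := by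
  have h0 := h.e_zero
  have h4 := h.e_four
  have h2 := h.map_two
  rw [tile012, Set.mem_ofPred_eq]
  constructor
  · rintro (hx | ⟨j, hj, y, hy, hxy⟩ | ⟨j, hj, y, hy, hxy⟩ | ⟨y, hy, hxy⟩)
    · obtain ⟨y, hy, hxy⟩ := (h.mem_two _).1 hx
      exact Or.inr ⟨y, Or.inl hy, hxy⟩
    · refine Or.inl ⟨j, hj, y - e 2, Or.inl (by simpa using hy), ?_⟩
      push_cast at hxy
      rw [map_sub]
      linear_combination (norm := module) hxy + h2 + h4 - h0
    · exact Or.inl ⟨j, hj, y, Or.inr hy, hxy⟩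
    · exact Or.inr ⟨y, Or.inr hy, hxy⟩
  · rintro (⟨j, hj, y, hy | hy, hxy⟩ | ⟨y, hy | hy, hxy⟩)
    · refine Or.inr (Or.inl ⟨j, hj, _, hy, ?_⟩)
      push_cast
      rw [map_add]
      linear_combination (norm := module) hxy - h2 - h4 + h0
    · exact Or.inr (Or.inr (Or.inl ⟨j, hj, y, hy, hxy⟩))
    · exact Or.inl ((h.mem_two _).2 ⟨y, hy, hxy⟩)
    · exact Or.inr (Or.inr (Or.inr ⟨y, hy, hxy⟩))

/-- The equation of `F 0` is used twice: the points `y` in its pieces `M y - (j e_0 + e_1)` are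
themselves split by `mem_zero_iff_tile012`. The resulting points `y - (j e_0 + e_4)` with `y ∈ F 2 ∪
F 4` are regrouped by `mem_two_or_four`; this is the role of both claims `key`. -/
lemma tile023 (h : IsTileFamily t M e F) (x : V) :
    x ∈ F 0 ∨ x + e 1 ∈ F 3 ↔
      (∃ j ≤ t, ∃ y ∈ tile012 t M e F, x = M y - ((j : ℤ) • e 0 + e 1)) ∨
      (∃ j < t, ∃ y, (∃ z ∈ tile012 t M e F, y = M z) ∧ x = M y - ((j : ℤ) • e 0 + e 4)) ∨
      ∃ y, (∃ z, (z + e 2 ∈ F 0 ∨ z ∈ F 3) ∧ y = M z) ∧ x = M y := by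
  have h0 := h.e_zero
  have h4 := h.e_four
  have h1 := h.map_one
  have h2 := h.map_two
  have h3 := h.map_three
  constructor
  · have key : ∀ j < t, ∀ y, (y ∈ F 2 ∨ y ∈ F 4) → x = y - ((j : ℤ) • e 0 + e 4) →
        (∃ j ≤ t, ∃ y ∈ tile012 t M e F, x = M y - ((j : ℤ) • e 0 + e 1)) ∨
        (∃ j < t, ∃ y, (∃ z ∈ tile012 t M e F, y = M z) ∧
          x = M y - ((j : ℤ) • e 0 + e 4)) := by
      intro j hj y hy hxy
      rcases (h.mem_two_or_four y).1 hy with hy | ⟨z, hz, rfl⟩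
      · obtain ⟨z, hz, hyz⟩ := (h.mem_three _).1 hy
        refine Or.inl ⟨j + 1, hj, z, Or.inl hz, ?_⟩
        push_cast
        linear_combination (norm := module) hxy + hyz - h4 + h0
      · exact Or.inr ⟨j, hj, _, ⟨z, hz, rfl⟩, hxy⟩
    rintro (hx | hx)
    · rcases (h.mem_zero _).1 hx with ⟨j, hj, y, hy, hxy⟩ | ⟨j, hj, y, hy, hxy⟩ | ⟨y, hy, hxy⟩
      · rcases (h.mem_zero_iff_tile012 y).1 (Or.inl hy) with ⟨z, hz, hyz⟩ | hy
        · rcases hj.lt_or_eq with hj | rfl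
          · rw [← or_assoc]
            refine Or.inl (key j hj (M (M z)) (Or.inl
              ((h.mem_two _).2 ⟨_, (h.mem_one _).2 ⟨z, hz, rfl⟩, rfl⟩)) ?_)
            rw [hyz, map_sub] at hxy
            linear_combination (norm := module) hxy - h1 + h4
          -- For `j = t` the total translation is `t e_0 + e_4 = M e_3 = M² e_2`, hence the witness
          -- `z - e 2`.
          · refine Or.inr (Or.inr ⟨_, ⟨z - e 2, Or.inl (by simpa using hz), rfl⟩, ?_⟩)
            rw [hyz, map_sub] at hxy
            rw [map_sub, map_sub, h2]
            linear_combination (norm := module) hxy - h1 + h3 + h4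
        · exact Or.inl ⟨j, hj, y, hy, hxy⟩
      · rw [← or_assoc]
        exact Or.inl (key j hj (M y) (Or.inr ((h.mem_four _).2 ⟨y, hy, rfl⟩)) hxy)
      · obtain ⟨z, hz, hyz⟩ := (h.mem_four _).1 hy
        exact Or.inr (Or.inr ⟨y, ⟨z, Or.inr hz, hyz⟩, hxy⟩)
    · obtain ⟨y, hy, hxy⟩ := (h.mem_three _).1 hx
      refine Or.inl ⟨0, t.zero_le, y, Or.inl hy, ?_⟩
      push_cast
      linear_combination (norm := module) hxy
  · have key : ∀ j < t, ∀ y, (y ∈ F 2 ∨ y ∈ F 4) → x = y - ((j : ℤ) • e 0 + e 4) → x ∈ F 0 := by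
      rintro j hj y (hy | hy) hxy
      · obtain ⟨z, hz, rfl⟩ := (h.mem_two _).1 hy
        obtain ⟨w, hw, rfl⟩ := (h.mem_one _).1 hz
        refine (h.mem_zero _).2 (Or.inl ⟨j, hj.le, M w - e 1,
          (h.mem_zero' _).2 (Or.inl ⟨w, hw, rfl⟩), ?_⟩)
        rw [map_sub]
        linear_combination (norm := module) hxy + h1 - h4
      · obtain ⟨z, hz, rfl⟩ := (h.mem_four _).1 hy
        exact (h.mem_zero _).2 (Or.inr (Or.inl ⟨j, hj, z, hz, hxy⟩))
    rintro (⟨j, hj, y, hy, hxy⟩ | ⟨j, hj, y, ⟨z, hz, rfl⟩, hxy⟩ | ⟨y, ⟨z, hz | hz, rfl⟩, hxy⟩)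
    · rcases (h.mem_zero_iff_tile012 y).2 (Or.inr hy) with hy | hy
      · exact Or.inl ((h.mem_zero _).2 (Or.inl ⟨j, hj, y, hy, hxy⟩))
      · have hy3 := (h.mem_three _).2 ⟨y, hy, rfl⟩
        rcases j with _ | j
        · refine Or.inr ?_
          push_cast at hxy
          convert hy3 using 1
          linear_combination (norm := module) hxy
        · refine Or.inl (key j hj (M y - e 3)
            ((h.mem_two_or_four _).2 (Or.inl (by simpa using hy3))) ?_)
          push_cast at hxy
          linear_combination (norm := module) hxy + h4 - h0
    · exact Or.inl (key j hj _ ((h.mem_two_or_four _).2 (Or.inr ⟨z, hz, rfl⟩)) hxy)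
    · refine Or.inl ((h.mem_zero _).2 (Or.inl ⟨t, le_rfl, M (z + e 2) - e 1,
          (h.mem_zero' _).2 (Or.inl ⟨_, hz, rfl⟩), ?_⟩))
      rw [map_sub, map_add, map_add, h2]
      linear_combination (norm := module) hxy + h1 - h3 - h4
    · exact Or.inl ((h.mem_zero _).2 (Or.inr (Or.inr
        ⟨_, (h.mem_four _).2 ⟨z, hz, rfl⟩, hxy⟩)))

end IsTileFamily

/-! ### The set equations in terms of successors under `E_3^*(σ_t)` -/

namespace IsTileFamily

variable {V : Type*} [AddCommGroup V] {t : ℕ} {M : V →+ V} {g : (Fin 5 → ℤ) →+ V}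
  {F : Fin 5 → Set V}

lemma exists_succ_iff {a : Wedge 5 3} {a₀ a₁ a₂ : Fin 5} (h01 : a₀ < a₁) (h12 : a₁ < a₂)
    (h : a.1 = {a₀, a₁, a₂}) (B : Finset (Fin 5) → Set V) (x : V) :
    (∃ b v, Succ (sigma t) a b v ∧ ∃ y ∈ B b.1, x = M y - g v) ↔
      ∃ b₀ s₀, Occ (sigma t) b₀ a₀ s₀ ∧ ∃ b₁ s₁, Occ (sigma t) b₁ a₁ s₁ ∧
      ∃ b₂ s₂, Occ (sigma t) b₂ a₂ s₂ ∧ ({b₀, b₁, b₂} : Finset (Fin 5)).card = 3 ∧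
        ∃ y ∈ B {b₀, b₁, b₂}, x = M y - (g s₀ + g s₁ + g s₂) := by
  simp only [succ_iff_of_eq h01 h12 h]
  constructor
  · rintro ⟨b, v, ⟨b₀, s₀, h₀, b₁, s₁, h₁, b₂, s₂, h₂, hb, rfl⟩, y, hy, hx⟩
    refine ⟨b₀, s₀, h₀, b₁, s₁, h₁, b₂, s₂, h₂, hb ▸ b.2, y, hb ▸ hy, ?_⟩
    rw [hx, map_add, map_add]
  · rintro ⟨b₀, s₀, h₀, b₁, s₁, h₁, b₂, s₂, h₂, hb, y, hy, hx⟩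
    refine ⟨⟨_, hb⟩, _, ⟨b₀, s₀, h₀, b₁, s₁, h₁, b₂, s₂, h₂, rfl, rfl⟩, y, hy, ?_⟩
    rw [hx, map_add, map_add]

lemma exists_occ_zero_iff (P : Fin 5 → (Fin 5 → ℤ) → Prop) :
    (∃ c s, Occ (sigma t) c 0 s ∧ P c s) ↔
      (∃ j ≤ t, P 0 ((j : ℤ) • Pi.single 0 1 + Pi.single 1 1)) ∨
      (∃ j < t, P 3 ((j : ℤ) • Pi.single 0 1 + Pi.single 4 1)) ∨ P 4 0 := by
  simp only [occ_sigma_zero]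
  constructor
  · rintro ⟨c, s, ⟨rfl, j, hj, rfl⟩ | ⟨rfl, j, hj, rfl⟩ | ⟨rfl, rfl⟩, h⟩
    · exact Or.inl ⟨j, hj, h⟩
    · exact Or.inr (Or.inl ⟨j, hj, h⟩)
    · exact Or.inr (Or.inr h)
  · rintro (⟨j, hj, h⟩ | ⟨j, hj, h⟩ | h)
    · exact ⟨0, _, Or.inl ⟨rfl, j, hj, rfl⟩, h⟩
    · exact ⟨3, _, Or.inr (Or.inl ⟨rfl, j, hj, rfl⟩), h⟩
    · exact ⟨4, 0, Or.inr (Or.inr ⟨rfl, rfl⟩), h⟩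

lemma exists_occ_iff_of {a d : Fin 5} (hd : ∀ c s, Occ (sigma t) c a s ↔ c = d ∧ s = 0)
    (P : Fin 5 → (Fin 5 → ℤ) → Prop) : (∃ c s, Occ (sigma t) c a s ∧ P c s) ↔ P d 0 := by
  simp only [hd]
  exact ⟨fun ⟨c, s, ⟨hc, hs⟩, h⟩ => hc ▸ hs ▸ h, fun h => ⟨d, 0, ⟨rfl, rfl⟩, h⟩⟩

/-- The sets `dualTile a` solve the set equations given by `E_3^*(σ_t)`. -/
lemma mem_dualTile (h : IsTileFamily t M (fun i => g (Pi.single i 1)) F) (a : Wedge 5 3) (x : V) :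
    x ∈ dualTile t M (fun i => g (Pi.single i 1)) F a.1 ↔
      ∃ b v, Succ (sigma t) a b v ∧
        ∃ y ∈ dualTile t M (fun i => g (Pi.single i 1)) F b.1, x = M y - g v := by
  have hcases : ∀ a : Finset (Fin 5), a.card = 3 → a = {0, 1, 4} ∨ a = {0, 3, 4} ∨ a = {0, 2, 4} ∨
      a = {0, 2, 3} ∨ a = {0, 1, 3} ∨ a = {0, 1, 2} ∨ a = {1, 2, 3} ∨ a = {2, 3, 4} ∨
      a = {1, 2, 4} ∨ a = {1, 3, 4} := by decide
  have c1 : ({4, 0, 3} : Finset (Fin 5)) = {0, 3, 4} := by decide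
  have c2 : ({4, 2, 3} : Finset (Fin 5)) = {2, 3, 4} := by decide
  have c3 : ({4, 1, 3} : Finset (Fin 5)) = {1, 3, 4} := by decide
  have c4 : ({3, 1, 2} : Finset (Fin 5)) = {1, 2, 3} := by decide
  have c5 : ({4, 1, 2} : Finset (Fin 5)) = {1, 2, 4} := by decide
  have c6 : ({3, 0, 2} : Finset (Fin 5)) = {0, 2, 3} := by decide
  have c7 : ({4, 0, 2} : Finset (Fin 5)) = {0, 2, 4} := by decide
  have c8 : ({3, 0, 1} : Finset (Fin 5)) = {0, 1, 3} := by decide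
  have c9 : ({4, 0, 1} : Finset (Fin 5)) = {0, 1, 4} := by decide
  have o1 := exists_occ_iff_of (t := t) (a := 1) fun _ _ => occ_sigma_one
  have o2 := exists_occ_iff_of (t := t) (a := 2) fun _ _ => occ_sigma_two
  have o3 := exists_occ_iff_of (t := t) (a := 3) fun _ _ => occ_sigma_three
  have o4 := exists_occ_iff_of (t := t) (a := 4) fun _ _ => occ_sigma_four
  have d1 : ∀ p q r : Fin 5, (p = q ∨ p = r ∨ q = r) → ¬ ({p, q, r} : Finset (Fin 5)).card = 3 := by
    decide
  have d2 : ∀ p q r : Fin 5, p ≠ q → p ≠ r → q ≠ r → ({p, q, r} : Finset (Fin 5)).card = 3 := by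
    decide
  rcases hcases a.1 a.2 with ha | ha | ha | ha | ha | ha | ha | ha | ha | ha <;>
    rw [exists_succ_iff (by decide) (by decide) ha, ha] <;>
    simp only [exists_occ_zero_iff, o1, o2, o3, o4, map_add, map_zsmul, map_zero, add_zero,
      sub_zero, d1, d2, c1, c2, c3, c4, c5, c6, c7, c8, c9, true_and, false_and, exists_false,
      false_or, or_false, and_false, ne_eq, Fin.reduceEq, not_false_eq_true, or_true]
  -- The types `{1,2,3}`, `{1,2,4}` and `{1,3,4}` are settled by unfolding; seven cases remain.
  all_goals simp +decide only [dualTile, if_true, if_false, Set.mem_ofPred_eq]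
  · exact h.tile014 x
  · exact h.tile034 x
  · exact h.tile024 x
  · exact h.tile023 x
  · exact h.tile013 x
  · exact h.mem_tile012 x
  · exact ⟨fun ⟨y, hy, hx⟩ => ⟨_, ⟨y, hy, rfl⟩, hx⟩, fun ⟨_, ⟨y, hy, hy'⟩, hx⟩ => ⟨y, hy, hy' ▸ hx⟩⟩

end IsTileFamily

/-! ### The projection to the contracting space -/

open Polynomial in
lemma pisotPoly_sigma (t : ℕ) : pisotPoly (sigma t) =
    X ^ 3 - C (t : ℝ) * X ^ 2 - C ((t : ℝ) + 1) * X - 1 := by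
  rw [pisotPoly, minpoly_sigma]; simp

open Polynomial in
lemma pisotPoly_div_sigma (t : ℕ) :
    pisotPoly (sigma t) /ₘ (X - C (pisotRoot (sigma t))) =
      X ^ 2 + C (pisotRoot (sigma t) - t) * X + C (pisotRoot (sigma t))⁻¹ := by
  obtain ⟨h, h1⟩ := pisotRoot_sigma t
  set β := pisotRoot (sigma t)
  have h0 : β ≠ 0 := by positivity
  have hinv : β⁻¹ = β ^ 2 - t * β - (t + 1) := by
    field_simp
    linear_combination -h
  refine (div_modByMonic_unique _ 0 (monic_X_sub_C β) ⟨?_, ?_⟩).1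
  · have h2 : (C β * C β⁻¹ : ℝ[X]) = 1 := by rw [← C_mul, mul_inv_cancel₀ h0, C_1]
    rw [pisotPoly_sigma]
    have h3 : (C β⁻¹ : ℝ[X]) = C β ^ 2 - C (t : ℝ) * C β - (C (t : ℝ) + 1) := by
      rw [hinv]; simp
    simp only [C_sub, C_add, C_1]
    linear_combination (-1 : ℝ[X]) * h2 + X * h3
  · rw [degree_zero, degree_X_sub_C]; exact WithBot.bot_lt_coe 1

lemma action_sigma_apply (t : ℕ) (x : Fin 5 → ℝ) :
    action (sigma t) x = ![(t + 1) * x 0 + t * x 3 + x 4, x 0, x 1, x 2, x 3] := by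
  rw [action, incidence_sigma, Matrix.toLin'_apply]
  ext i
  fin_cases i <;> simp [Matrix.mulVec, dotProduct, Fin.sum_univ_succ]
  ring

/-- `M_σ` as an action on real vectors extends its action on the lattice. -/
lemma action_intCast {n : ℕ} (σ : Subst n) (x : Fin n → ℤ) :
    action σ (fun i => (x i : ℝ)) = fun i => ((incidence σ).mulVec x i : ℝ) := by
  rw [action, Matrix.toLin'_apply]
  ext i
  simp [Matrix.mulVec, dotProduct]

lemma piC_mem (t : ℕ) (x : Fin 5 → ℝ) : piC t x ∈ Kc (sigma t) :=
  Submodule.projection_apply_mem _ x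

lemma piC_action (t : ℕ) (x : Fin 5 → ℝ) : piC t (action (sigma t) x) =
    action (sigma t) (piC t x) := by
  have hcomm : ∀ (p : Polynomial ℝ) (y : Fin 5 → ℝ),
      Polynomial.aeval (action (sigma t)) p (action (sigma t) y) =
        action (sigma t) (Polynomial.aeval (action (sigma t)) p y) := fun p y => by
    have := congrArg (fun q => Polynomial.aeval (action (sigma t)) q y) (mul_comm p Polynomial.X)
    simpa using this
  have hc : ∀ y ∈ Kc (sigma t), action (sigma t) y ∈ Kc (sigma t) := fun y hy => by
    rw [Kc, LinearMap.mem_ker] at hy ⊢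
    rw [hcomm, hy, map_zero]
  have he : ∀ y ∈ Ke (sigma t) ⊔ Kn (sigma t),
      action (sigma t) y ∈ Ke (sigma t) ⊔ Kn (sigma t) := by
    intro y hy
    obtain ⟨a, ha, b, hb, rfl⟩ := Submodule.mem_sup.1 hy
    rw [map_add]
    refine Submodule.add_mem_sup ?_ ?_
    · rw [Ke, LinearMap.mem_ker] at ha ⊢
      rw [hcomm, ha, map_zero]
    · obtain ⟨z, rfl⟩ := hb
      exact ⟨action (sigma t) z, hcomm _ _⟩
  have hr : x - piC t x ∈ Ke (sigma t) ⊔ Kn (sigma t) := by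
    rw [← Submodule.projection_apply_eq_zero_iff (isCompl_sigma t)]
    change piC t (x - piC t x) = 0
    rw [map_sub, sub_eq_zero]
    exact (Submodule.projection_apply_of_mem_left (isCompl_sigma t) (piC_mem t x)).symm
  have h1 : piC t (action (sigma t) (piC t x)) = action (sigma t) (piC t x) :=
    Submodule.projection_apply_of_mem_left (isCompl_sigma t) (hc _ (piC_mem t x))
  have h2 : piC t (action (sigma t) (x - piC t x)) = 0 :=
    (Submodule.projection_apply_eq_zero_iff (isCompl_sigma t)).2 (he _ hr)
  rw [map_sub, map_sub, h1, sub_eq_zero] at h2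
  exact h2

lemma piC_eq_zero_of_mem_Kn (t : ℕ) {x : Fin 5 → ℝ} (hx : x ∈ Kn (sigma t)) : piC t x = 0 :=
  (Submodule.projection_apply_eq_zero_iff (isCompl_sigma t)).2 (Submodule.mem_sup_right hx)

lemma aeval_pisotPoly_sigma (t : ℕ) (y : Fin 5 → ℝ) :
    Polynomial.aeval (action (sigma t)) (pisotPoly (sigma t)) y =
      action (sigma t) (action (sigma t) (action (sigma t) y)) -
        (t : ℝ) • action (sigma t) (action (sigma t) y) - ((t : ℝ) + 1) • action (sigma t) y - y := by
  rw [pisotPoly_sigma]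
  simp [pow_succ, Algebra.smul_def, sub_eq_add_neg, add_mul]

lemma piC_single_zero (t : ℕ) : piC t (Pi.single 0 1) =
    piC t (Pi.single 2 1) + piC t (Pi.single 3 1) := by
  rw [← map_add, ← sub_eq_zero, ← map_sub]
  -- The vector `y = (0, t, 1, 0, 0)` satisfies `f(M) y = (t² + t + 1)(e_0 - e_2 - e_3)`.
  refine piC_eq_zero_of_mem_Kn t ⟨((t : ℝ) ^ 2 + t + 1)⁻¹ • (![0, t, 1, 0, 0] : Fin 5 → ℝ), ?_⟩
  have hD : ((t : ℝ) ^ 2 + t + 1) ≠ 0 := by positivity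
  rw [map_smul, inv_smul_eq_iff₀ hD, aeval_pisotPoly_sigma]
  simp only [action_sigma_apply]
  ext i
  fin_cases i <;> simp <;> ring

lemma piC_single_four (t : ℕ) : piC t (Pi.single 4 1) =
    piC t (Pi.single 1 1) + piC t (Pi.single 2 1) := by
  rw [← map_add, ← sub_eq_zero, ← map_sub]
  -- Here `y = (0, t + 1, -t, 0, 0)` satisfies `f(M) y = (t² + t + 1)(e_4 - e_1 - e_2)`.
  refine piC_eq_zero_of_mem_Kn t ⟨((t : ℝ) ^ 2 + t + 1)⁻¹ • (![0, t + 1, -t, 0, 0] : Fin 5 → ℝ), ?_⟩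
  have hD : ((t : ℝ) ^ 2 + t + 1) ≠ 0 := by positivity
  rw [map_smul, inv_smul_eq_iff₀ hD, aeval_pisotPoly_sigma]
  simp only [action_sigma_apply]
  ext i
  fin_cases i <;> simp <;> ring

/-! ### Contraction -/

/-- The hypotheses place the roots of `X² + pX + c` in the open unit disc. They persist after
rescaling the sequence by some `ρ < 1` close to 1, and a quadratic Lyapunov function bounds the
rescaled sequence. No complex roots are needed. -/
lemma exists_geometric_bound {p c : ℝ} (hc0 : 0 < c) (hc1 : c < 1) (hp0 : 0 ≤ p)
    (hp1 : p < 1 + c) : ∃ ρ : ℝ, 0 < ρ ∧ ρ < 1 ∧ ∀ a : ℕ → ℝ,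
      (∀ k, a (k + 2) + p * a (k + 1) + c * a k = 0) → ∃ K, ∀ k, |a k| ≤ K * ρ ^ k := by
  obtain ⟨ρ, ⟨⟨hρ0, hρc⟩, hρp⟩, hρ1⟩ : ∃ ρ : ℝ, ((0 < ρ ∧ c < ρ ^ 2) ∧ p * ρ < ρ ^ 2 + c) ∧
      ρ < 1 := by
    have h : ∀ᶠ ρ in nhds (1 : ℝ), (0 < ρ ∧ c < ρ ^ 2) ∧ p * ρ < ρ ^ 2 + c := by
      refine ((lt_mem_nhds one_pos).and ?_).and ?_
      · exact ContinuousAt.eventually_lt (by fun_prop) (by fun_prop) (by simpa using hc1)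
      · exact ContinuousAt.eventually_lt (by fun_prop) (by fun_prop) (by simpa using hp1)
    exact ((h.filter_mono nhdsWithin_le_nhds).and (self_mem_nhdsWithin (s := Set.Iio 1))).exists
  refine ⟨ρ, hρ0, hρ1, fun a ha => ?_⟩
  set C := c / ρ ^ 2 with hC
  set P := p / ρ with hP
  have hC1 : C < 1 := (div_lt_one (by positivity)).2 hρc
  have hP0 : 0 ≤ P := by positivity
  have hPC : P < 1 + C := by
    rw [hP, hC, div_lt_iff₀ hρ0]
    have : (1 + c / ρ ^ 2) * ρ = (ρ ^ 2 + c) / ρ := by field_simp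
    rw [this, lt_div_iff₀ hρ0]
    exact hρp
  set b : ℕ → ℝ := fun k => a k / ρ ^ k with hb
  have hrec : ∀ k, b (k + 2) = -P * b (k + 1) - C * b k := by
    intro k
    simp only [hb, hP, hC, pow_succ]
    field_simp
    linear_combination ha k
  -- This form is positive definite because `P < 1 + C`, and it does not increase along the
  -- recursion because `C < 1`.
  set W : ℕ → ℝ := fun k => (1 + C) * (b k ^ 2 + b (k + 1) ^ 2) + 2 * P * b k * b (k + 1) with hW
  have hWle : ∀ k, W k ≤ W 0 := by
    intro k
    induction k with
    | zero => exact le_rfl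
    | succ k ih =>
      refine le_trans ?_ ih
      have : W (k + 1) - W k = -(1 - C) * (b (k + 2) - b k) ^ 2 := by
        simp only [hW, hrec k]
        ring
      nlinarith [mul_nonneg (sub_nonneg.2 hC1.le) (sq_nonneg (b (k + 2) - b k))]
  have hWge : ∀ k, (1 + C - P) * b k ^ 2 ≤ W k := by
    intro k
    have : W k - (1 + C - P) * b k ^ 2 =
        P * (b k + b (k + 1)) ^ 2 + (1 + C - P) * b (k + 1) ^ 2 := by
      simp only [hW]; ring
    nlinarith [mul_nonneg hP0 (sq_nonneg (b k + b (k + 1))),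
      mul_nonneg (sub_nonneg.2 hPC.le) (sq_nonneg (b (k + 1)))]
  refine ⟨1 + W 0 / (1 + C - P), fun k => ?_⟩
  have h1 : b k ^ 2 ≤ W 0 / (1 + C - P) := by
    rw [le_div_iff₀ (by linarith), mul_comm]
    exact (hWge k).trans (hWle k)
  have h2 : |b k| ≤ 1 + W 0 / (1 + C - P) := by
    have := sq_abs (b k)
    nlinarith [sq_nonneg (|b k| - 1), abs_nonneg (b k)]
  have h3 : a k = b k * ρ ^ k := by simp only [hb]; field_simp
  rw [h3, abs_mul, abs_of_pos (pow_pos hρ0 k)]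
  exact mul_le_mul_of_nonneg_right h2 (by positivity)

lemma action_action_piC (t : ℕ) (x : Fin 5 → ℝ) :
    action (sigma t) (action (sigma t) (piC t x)) +
      (pisotRoot (sigma t) - t) • action (sigma t) (piC t x) +
      (pisotRoot (sigma t))⁻¹ • piC t x = 0 := by
  have h := piC_mem t x
  rw [Kc, pisotPoly_div_sigma, LinearMap.mem_ker] at h
  simpa [pow_succ, Algebra.smul_def, sub_mul] using h

/-- `M_σ` contracts the contracting space exponentially. -/
lemma exists_contraction (t : ℕ) : ∃ ρ : ℝ, 0 < ρ ∧ ρ < 1 ∧ ∃ K, 0 ≤ K ∧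
    ∀ (x : Fin 5 → ℝ) (k : ℕ), ‖(action (sigma t) ^ k) (piC t x)‖ ≤ K * ‖x‖ * ρ ^ k := by
  obtain ⟨h, h1⟩ := pisotRoot_sigma t
  set β := pisotRoot (sigma t) with hβ
  have hβ0 : 0 < β := by positivity
  have ht : (0 : ℝ) ≤ t := t.cast_nonneg
  have hinv : β⁻¹ = β ^ 2 - t * β - (t + 1) := by
    field_simp
    linear_combination -h
  have hinv0 : 0 < β⁻¹ := by positivity
  have hinv1 : β⁻¹ < 1 := inv_lt_one_of_one_lt₀ h1
  have hp0 : 0 ≤ β - t := by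
    have : 0 < β * (β - t) := by nlinarith
    exact (pos_of_mul_pos_right this hβ0.le).le
  have hp1 : β - t < 1 + β⁻¹ := by
    -- This is `f(-1) = -1`, read off the factorization `f = (X - β)(X² + (β - t)X + β⁻¹)`.
    have : (1 + β⁻¹ - (β - t)) * (1 + β) = 1 := by
      rw [hinv]
      linear_combination h
    nlinarith [pos_of_mul_pos_left (by rw [this]; exact one_pos) (by positivity : 0 ≤ 1 + β)]
  obtain ⟨ρ, hρ0, hρ1, hρ⟩ := exists_geometric_bound hinv0 hinv1 hp0 hp1
  have hpi : ∀ k x, (action (sigma t) ^ k) (piC t x) = piC t ((action (sigma t) ^ k) x) := by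
    intro k x
    induction k with
    | zero => rfl
    | succ k ih => rw [pow_succ', Module.End.mul_apply, ih, ← piC_action, Module.End.mul_apply]
  have hi : ∀ l i, ∃ K, ∀ k, |(action (sigma t) ^ k) (piC t (Pi.single l 1)) i| ≤ K * ρ ^ k := by
    intro l i
    refine hρ (fun k => (action (sigma t) ^ k) (piC t (Pi.single l 1)) i) fun k => ?_
    have := congrFun (action_action_piC t ((action (sigma t) ^ k) (Pi.single l 1))) i
    rw [← hpi] at this
    simpa [pow_succ' _ (k + 1), pow_succ' _ k] using this
  choose K hK using hi
  refine ⟨ρ, hρ0, hρ1, ∑ l, ∑ i, |K l i|, by positivity, fun x k => ?_⟩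
  have hx : x = ∑ l, x l • (Pi.single l 1 : Fin 5 → ℝ) := by
    ext i; simp [Finset.sum_apply, Pi.single_apply]
  have hl : ∀ l, ‖(action (sigma t) ^ k) (piC t (Pi.single l 1))‖ ≤ (∑ i, |K l i|) * ρ ^ k := by
    intro l
    rw [pi_norm_le_iff_of_nonneg (by positivity)]
    intro i
    refine (hK l i k).trans (mul_le_mul_of_nonneg_right ?_ (by positivity))
    exact (le_abs_self _).trans (Finset.single_le_sum (f := fun i => |K l i|)
      (fun _ _ => abs_nonneg _) (Finset.mem_univ i))
  calc ‖(action (sigma t) ^ k) (piC t x)‖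
      = ‖∑ l, x l • (action (sigma t) ^ k) (piC t (Pi.single l 1))‖ := by
        conv_lhs => rw [hx]
        simp only [map_sum, map_smul]
    _ ≤ ∑ l, ‖x‖ * ((∑ i, |K l i|) * ρ ^ k) := by
        refine norm_sum_le_of_le _ fun l _ => ?_
        rw [norm_smul]
        exact mul_le_mul (norm_le_pi_norm x l) (hl l) (norm_nonneg _) (norm_nonneg _)
    _ = (∑ l, ∑ i, |K l i|) * ‖x‖ * ρ ^ k := by
        rw [← Finset.mul_sum, ← Finset.sum_mul]; ring

/-! ### Subtiles -/

/-- The projection `π_c` restricted to the lattice `ℤ^5`. -/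
noncomputable def latticeProj (t : ℕ) : (Fin 5 → ℤ) →+ (Fin 5 → ℝ) where
  toFun x := piC t fun i => (x i : ℝ)
  map_zero' := by
    have : (fun i => (((0 : Fin 5 → ℤ) i : ℤ) : ℝ)) = 0 := by ext i; simp
    rw [this, map_zero]
  map_add' x y := by
    rw [← map_add]
    congr 1
    ext i; simp

lemma latticeProj_apply (t : ℕ) (x : Fin 5 → ℤ) :
    latticeProj t x = piC t fun i => (x i : ℝ) := rfl

lemma latticeProj_single (t : ℕ) (i : Fin 5) :
    latticeProj t (Pi.single i 1) = piC t (Pi.single i 1) := by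
  rw [latticeProj_apply]
  congr 1
  ext j
  by_cases h : j = i
  · subst h; simp
  · simp [h]

lemma latticeProj_mulVec (t : ℕ) (x : Fin 5 → ℤ) :
    latticeProj t ((incidence (sigma t)).mulVec x) = action (sigma t) (latticeProj t x) := by
  rw [latticeProj_apply, latticeProj_apply, ← action_intCast, piC_action]

lemma latticeProj_single_zero (t : ℕ) : latticeProj t (Pi.single 0 1) =
    latticeProj t (Pi.single 2 1) + latticeProj t (Pi.single 3 1) := by
  simp only [latticeProj_single, piC_single_zero t]

lemma latticeProj_single_four (t : ℕ) : latticeProj t (Pi.single 4 1) =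
    latticeProj t (Pi.single 1 1) + latticeProj t (Pi.single 2 1) := by
  simp only [latticeProj_single, piC_single_four t]

/-- `χ` replaces 0 by `2 3` and 4 by `2 1`, in accordance with `e_0 = e_2 + e_3` and `e_4 = e_1 +
e_2`. -/
lemma latticeProj_chi_mulVec (t : ℕ) (x : Fin 5 → ℤ) :
    latticeProj t ((incidence chi).mulVec x) = latticeProj t x := by
  have : (latticeProj t).comp (Matrix.mulVecLin (incidence chi)).toAddMonoidHom =
      latticeProj t := by
    refine AddMonoidHom.functions_ext' _ _ _ fun i => AddMonoidHom.ext_int ?_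
    simp only [AddMonoidHom.comp_apply, AddMonoidHom.single_apply, LinearMap.toAddMonoidHom_coe,
      Matrix.mulVecLin_apply, incidence_mulVec_single]
    fin_cases i <;>
      simp [chi, abel_cons, abel_nil, latticeProj_single_zero, latticeProj_single_four, add_comm]
  exact DFunLike.congr_fun this x

/-- The points `π_c(l(u_0 ⋯ u_N))` with `u_N = c`. -/
def subtile (t : ℕ) (u : ℕ → Fin 5) (c : Fin 5) : Set (Fin 5 → ℝ) :=
  latticeProj t '' prefixSet u c

lemma mem_subtile_iff {t : ℕ} {u : ℕ → Fin 5} (hu : (sigma t).onInf u = u) (a : Fin 5)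
    (x : Fin 5 → ℝ) : x ∈ subtile t u a ↔ ∃ c s, Occ (sigma t) c a s ∧
      ∃ y ∈ subtile t u c, x = action (sigma t) y - latticeProj t s := by
  have h := mem_prefixSet_onInf (sigma_ne_nil t) u a
  rw [hu] at h
  simp only [subtile, Set.mem_image, h]
  constructor
  · rintro ⟨_, ⟨c, s, hs, y, hy, rfl⟩, rfl⟩
    exact ⟨c, s, hs, _, ⟨y, hy, rfl⟩, by rw [map_sub, latticeProj_mulVec]⟩
  · rintro ⟨c, s, hs, _, ⟨y, hy, rfl⟩, rfl⟩
    exact ⟨_, ⟨c, s, hs, y, hy, rfl⟩, by rw [map_sub, latticeProj_mulVec]⟩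

lemma isTileFamily_subtile {t : ℕ} {u : ℕ → Fin 5} (hu : (sigma t).onInf u = u) :
    IsTileFamily t (action (sigma t)).toAddMonoidHom (fun i => latticeProj t (Pi.single i 1))
      (subtile t u) where
  e_zero := latticeProj_single_zero t
  e_four := latticeProj_single_four t
  map_one := by
    simp only [LinearMap.toAddMonoidHom_coe]
    rw [← latticeProj_mulVec, incidence_mulVec_single]
    simp [sigma, abel_cons, abel_nil]
  map_two := by
    simp only [LinearMap.toAddMonoidHom_coe]
    rw [← latticeProj_mulVec, incidence_mulVec_single]
    simp [sigma, abel_cons, abel_nil]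
  map_three := by
    simp only [LinearMap.toAddMonoidHom_coe]
    rw [← latticeProj_mulVec, incidence_mulVec_single]
    simp only [← map_zsmul, ← map_add]
    simp [sigma, abel_cons, abel_nil, abel_append, abel_replicate]
  mem_zero x := by
    rw [mem_subtile_iff hu, IsTileFamily.exists_occ_zero_iff]
    simp only [map_add, map_zsmul, map_zero, sub_zero, LinearMap.toAddMonoidHom_coe]
  mem_one x := by
    rw [mem_subtile_iff hu, IsTileFamily.exists_occ_iff_of fun _ _ => occ_sigma_one]
    simp
  mem_two x := by
    rw [mem_subtile_iff hu, IsTileFamily.exists_occ_iff_of fun _ _ => occ_sigma_two]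
    simp
  mem_three x := by
    rw [mem_subtile_iff hu, IsTileFamily.exists_occ_iff_of fun _ _ => occ_sigma_three]
    simp
  mem_four x := by
    rw [mem_subtile_iff hu, IsTileFamily.exists_occ_iff_of fun _ _ => occ_sigma_four]
    simp

/-- The solution of the set equations of `E_3^*(σ_t)` made of the subtiles. -/
noncomputable def dualSubtile (t : ℕ) (u : ℕ → Fin 5) (a : Finset (Fin 5)) : Set (Fin 5 → ℝ) :=
  dualTile t (action (sigma t)).toAddMonoidHom (fun i => latticeProj t (Pi.single i 1))
    (subtile t u) a

lemma mem_dualSubtile_iff {t : ℕ} {u : ℕ → Fin 5} (hu : (sigma t).onInf u = u) (a : Wedge 5 3)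
    (x : Fin 5 → ℝ) : x ∈ dualSubtile t u a.1 ↔ ∃ b v, Succ (sigma t) a b v ∧
      ∃ y ∈ dualSubtile t u b.1, x = action (sigma t) y - latticeProj t v :=
  (isTileFamily_subtile hu).mem_dualTile a x

/-! ### The word `χ(u)` in terms of subtiles -/

lemma occ_chi_iff {c a : Fin 5} {s : Fin 5 → ℤ} : Occ chi c a s ↔
    (c = 0 ∧ a = 2 ∧ s = Pi.single 3 1) ∨ (c = 0 ∧ a = 3 ∧ s = 0) ∨ (c = 1 ∧ a = 1 ∧ s = 0) ∨
    (c = 2 ∧ a = 2 ∧ s = 0) ∨ (c = 3 ∧ a = 3 ∧ s = 0) ∨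
    (c = 4 ∧ a = 2 ∧ s = Pi.single 1 1) ∨ (c = 4 ∧ a = 1 ∧ s = 0) := by
  have hpair : ∀ x y : Fin 5, ∀ c, chi c = [x, y] →
      (Occ chi c a s ↔ (a = x ∧ s = Pi.single y 1) ∨ (a = y ∧ s = 0)) := by
    intro x y c h
    rw [Occ, h]
    constructor
    · rintro ⟨_ | ⟨b, p⟩, r, hr, rfl⟩
      · simp only [List.nil_append, List.cons.injEq] at hr
        obtain ⟨rfl, rfl⟩ := hr
        exact Or.inl ⟨rfl, by simp [abel_cons, abel_nil]⟩
      · rcases p with _ | ⟨b', p⟩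
        · simp only [List.cons_append, List.nil_append, List.cons.injEq] at hr
          obtain ⟨rfl, rfl, rfl⟩ := hr
          exact Or.inr ⟨rfl, abel_nil⟩
        · simp at hr
    · rintro (⟨rfl, rfl⟩ | ⟨rfl, rfl⟩)
      · exact ⟨[], [y], rfl, by simp [abel_cons, abel_nil]⟩
      · exact ⟨[x], [], rfl, abel_nil.symm⟩
  have h0 := hpair 2 3 0 rfl
  have h1 := occ_singleton_iff (a := a) (s := s) (show chi 1 = [1] from rfl)
  have h2 := occ_singleton_iff (a := a) (s := s) (show chi 2 = [2] from rfl)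
  have h3 := occ_singleton_iff (a := a) (s := s) (show chi 3 = [3] from rfl)
  have h4 := hpair 2 1 4 rfl
  fin_cases c <;> simp [h0, h1, h2, h3, h4]

/-- Each occurrence of `a` in some `χ(c)` contributes `F(c)` translated by minus its suffix, because
`χ` is invisible to `π_c` on the prefix. This explains the form of the three sets attached to `{0,
a, 4}`. -/
lemma latticeProj_prefixSet_chi (t : ℕ) (u : ℕ → Fin 5) {a : Fin 5} (ha : a = 1 ∨ a = 2 ∨ a = 3) :
    latticeProj t '' prefixSet (chi.onInf u) a = dualSubtile t u {0, a, 4} := by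
  have hmem : ∀ x, x ∈ latticeProj t '' prefixSet (chi.onInf u) a ↔ ∃ c s, Occ chi c a s ∧
      x + latticeProj t s ∈ subtile t u c := by
    intro x
    simp only [subtile, Set.mem_image, mem_prefixSet_onInf chi_ne_nil]
    constructor
    · rintro ⟨_, ⟨c, s, hs, y, hy, rfl⟩, rfl⟩
      exact ⟨c, s, hs, y, hy, by rw [map_sub, latticeProj_chi_mulVec, sub_add_cancel]⟩
    · rintro ⟨c, s, hs, y, hy, hx⟩
      exact ⟨_, ⟨c, s, hs, y, hy, rfl⟩, by
        rw [map_sub, latticeProj_chi_mulVec, hx, add_sub_cancel_right]⟩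
  ext x
  rw [hmem]
  constructor
  · rintro ⟨c, s, hs, h⟩
    rcases occ_chi_iff.1 hs with ⟨rfl, rfl, rfl⟩ | ⟨rfl, rfl, rfl⟩ | ⟨rfl, rfl, rfl⟩ |
      ⟨rfl, rfl, rfl⟩ | ⟨rfl, rfl, rfl⟩ | ⟨rfl, rfl, rfl⟩ | ⟨rfl, rfl, rfl⟩ <;>
      simp +decide only [dualSubtile, dualTile, if_true, if_false, Set.mem_ofPred_eq]
    all_goals
      try simp only [map_zero, add_zero] at h
      simp only [h, true_or, or_true]
  · rcases ha with rfl | rfl | rfl <;>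
      simp +decide only [dualSubtile, dualTile, if_true, if_false, Set.mem_ofPred_eq]
    · rintro (h | h)
      exacts [⟨1, 0, by simp [occ_chi_iff], by simpa using h⟩,
        ⟨4, 0, by simp [occ_chi_iff], by simpa using h⟩]
    · rintro (h | h | h)
      exacts [⟨2, 0, by simp [occ_chi_iff], by simpa using h⟩,
        ⟨0, _, occ_chi_iff.2 (Or.inl ⟨rfl, rfl, rfl⟩), h⟩,
        ⟨4, Pi.single 1 1, occ_chi_iff.2 (by simp), h⟩]
    · rintro (h | h)
      exacts [⟨3, 0, by simp [occ_chi_iff], by simpa using h⟩,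
        ⟨0, 0, by simp [occ_chi_iff], by simpa using h⟩]

/-- The translation by `π_c(e_a)` appends the letter `w_N = a` to the prefix `w_0 ⋯ w_{N-1}`, as the
convention of `prefixSet` requires. -/
lemma lineTile_add (t : ℕ) (u : ℕ → Fin 5) {a : Fin 5} (ha : a = 1 ∨ a = 2 ∨ a = 3) :
    (fun x => x + piC t (Pi.single a 1)) '' lineTile t u a =
      closure (dualSubtile t u {0, a, 4}) := by
  rw [lineTile, ← latticeProj_prefixSet_chi t u ha]
  rw [show (fun x => x + piC t (Pi.single a 1)) = Homeomorph.addRight (piC t (Pi.single a 1)) from rfl,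
    Homeomorph.image_closure]
  congr 1
  have hN : ∀ N, chi.onInf u N = a →
      latticeProj t (abel ((List.range (N + 1)).map (chi.onInf u))) =
      piC t (fun i => (abel ((List.range N).map (chi.onInf u)) i : ℝ)) + piC t (Pi.single a 1) := by
    intro N hN
    rw [List.range_succ, List.map_append, abel_append, List.map_singleton, hN, abel_cons, abel_nil,
      add_zero, map_add, latticeProj_single, latticeProj_apply]
  ext x
  constructor
  · rintro ⟨_, ⟨N, h, rfl⟩, rfl⟩
    exact ⟨_, ⟨N, h, rfl⟩, hN N h⟩
  · rintro ⟨_, ⟨N, h, rfl⟩, rfl⟩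
    exact ⟨_, ⟨N, h, rfl⟩, (hN N h).symm⟩

/-! ### Boundedness of the subtiles -/

/-- The iterates of `A` decay uniformly like `ρ ^ k` on `S`. -/
def DecaysOn {V : Type*} [SeminormedAddCommGroup V] [Module ℝ V] (A : Module.End ℝ V) (ρ : ℝ)
    (S : Set V) : Prop :=
  ∃ K, ∀ x ∈ S, ∀ k, ‖(A ^ k) x‖ ≤ K * ρ ^ k

namespace DecaysOn

variable {V : Type*} [SeminormedAddCommGroup V] [Module ℝ V] {A : Module.End ℝ V} {ρ : ℝ}
  {S T : Set V}

lemma mono (h : DecaysOn A ρ T) (hST : S ⊆ T) : DecaysOn A ρ S :=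
  let ⟨K, hK⟩ := h
  ⟨K, fun x hx => hK x (hST hx)⟩

lemma union (hρ : 0 < ρ) (hS : DecaysOn A ρ S) (hT : DecaysOn A ρ T) : DecaysOn A ρ (S ∪ T) := by
  obtain ⟨K, hK⟩ := hS
  obtain ⟨L, hL⟩ := hT
  refine ⟨max K L, ?_⟩
  rintro x (hx | hx) k
  · exact (hK x hx k).trans (mul_le_mul_of_nonneg_right (le_max_left _ _) (by positivity))
  · exact (hL x hx k).trans (mul_le_mul_of_nonneg_right (le_max_right _ _) (by positivity))

lemma translate {v : V} (hv : DecaysOn A ρ {v}) (hS : DecaysOn A ρ S) :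
    DecaysOn A ρ {x | x + v ∈ S} := by
  obtain ⟨K, hK⟩ := hS
  obtain ⟨L, hL⟩ := hv
  refine ⟨K + L, fun x hx k => ?_⟩
  have : (A ^ k) x = (A ^ k) (x + v) - (A ^ k) v := by rw [map_add, add_sub_cancel_right]
  rw [this, add_mul]
  exact (norm_sub_le _ _).trans (add_le_add (hK _ hx k) (hL v rfl k))

lemma image (hS : DecaysOn A ρ S) : DecaysOn A ρ (A '' S) := by
  obtain ⟨K, hK⟩ := hS
  refine ⟨K * ρ, ?_⟩
  rintro _ ⟨x, hx, rfl⟩ k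
  rw [← Module.End.mul_apply, ← pow_succ, mul_assoc, ← pow_succ']
  exact hK x hx (k + 1)

end DecaysOn

lemma Occ.abs_le_length {n : ℕ} {τ : Subst n} {c a : Fin n} {s : Fin n → ℤ} (h : Occ τ c a s)
    (i : Fin n) : |s i| ≤ (τ c).length := by
  obtain ⟨p, r, h, rfl⟩ := h
  rw [abel, abs_of_nonneg (Int.natCast_nonneg _), h]
  have := List.count_le_length (a := i) (l := r)
  simp only [List.length_append, List.length_cons]
  omega

/-- Only the letter 0 has an image that begins with itself. -/
lemma fixedPoint_sigma_zero {t : ℕ} {u : ℕ → Fin 5} (hu : (sigma t).onInf u = u) : u 0 = 0 := by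
  have h := congrFun hu 0
  simp only [Subst.onInf, zero_add, List.range_one, List.flatMap_singleton] at h
  generalize u 0 = a at h
  fin_cases a
  · rfl
  · simp [sigma] at h
  · simp [sigma] at h
  · rcases t with _ | t <;> simp [sigma, List.replicate_succ] at h
  · simp [sigma] at h

/-- The strict growth makes the desubstituted prefix strictly shorter, so that the induction in
`decaysOn_prefix` descends. -/
lemma lt_length_imagePrefix_sigma {t : ℕ} {u : ℕ → Fin 5} (hu : u 0 = 0) (m : ℕ) :
    m + 1 < (imagePrefix (sigma t) u (m + 1)).length := by
  induction m with
  | zero => simp [imagePrefix, hu, sigma]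
  | succ m ih =>
    have := List.length_pos_iff.2 (sigma_ne_nil t (u (m + 1)))
    rw [imagePrefix_succ, List.length_append]
    omega

lemma decaysOn_latticeProj {t : ℕ} {ρ K : ℝ}
    (hK : ∀ (x : Fin 5 → ℝ) (k : ℕ), ‖(action (sigma t) ^ k) (piC t x)‖ ≤ K * ‖x‖ * ρ ^ k)
    (v : Fin 5 → ℤ) : DecaysOn (action (sigma t)) ρ {latticeProj t v} := by
  refine ⟨K * ‖fun i => (v i : ℝ)‖, ?_⟩
  rintro _ rfl k
  exact hK _ k

/-- A prefix is the image of a shorter one minus a suffix of bounded length, so its norm is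
controlled by a geometric series. Bounding all iterates of `M` at once makes the induction close
although one application of `M` need not shrink the norm on `𝕂_c`. -/
lemma decaysOn_prefix {t : ℕ} {u : ℕ → Fin 5} (hu : (sigma t).onInf u = u) {ρ K : ℝ}
    (hρ0 : 0 < ρ) (hρ1 : ρ < 1) (hK0 : 0 ≤ K)
    (hK : ∀ (x : Fin 5 → ℝ) (k : ℕ), ‖(action (sigma t) ^ k) (piC t x)‖ ≤ K * ‖x‖ * ρ ^ k) :
    ∃ L, ∀ N k, ‖(action (sigma t) ^ k)
      (latticeProj t (abel ((List.range (N + 1)).map u)))‖ ≤ L * ρ ^ k := by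
  have hu0 := fixedPoint_sigma_zero hu
  set B : ℝ := K * (t + 2) with hB
  have hB0 : 0 ≤ B := by positivity
  have hlen : ∀ c, (sigma t c).length ≤ t + 2 := by
    intro c; fin_cases c <;> simp [sigma]
  have hnorm : ∀ (s : Fin 5 → ℤ), (∀ i, |s i| ≤ (t + 2 : ℕ)) → ∀ k,
      ‖(action (sigma t) ^ k) (latticeProj t s)‖ ≤ B * ρ ^ k := by
    intro s hs k
    refine (hK _ k).trans (mul_le_mul_of_nonneg_right (mul_le_mul_of_nonneg_left ?_ hK0)
      (by positivity))
    rw [pi_norm_le_iff_of_nonneg (by positivity)]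
    intro i
    rw [Real.norm_eq_abs]
    exact_mod_cast hs i
  have h1ρ : 0 < 1 - ρ := by linarith
  -- The constant `L` solves `L ρ + B = L`, which is what the inductive step needs.
  refine ⟨B / (1 - ρ), fun N => ?_⟩
  have hBL : B ≤ B / (1 - ρ) := by
    rw [le_div_iff₀ h1ρ]; nlinarith
  induction N using Nat.strong_induction_on with
  | _ N ih =>
    rcases Nat.eq_zero_or_pos N with rfl | hN
    · intro k
      refine (hnorm _ (fun i => ?_) k).trans (mul_le_mul_of_nonneg_right hBL (by positivity))
      have h1 : (List.range (0 + 1)).map u = [u 0] := rfl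
      rw [h1, abel, abs_of_nonneg (Int.natCast_nonneg _)]
      have := List.count_le_length (a := i) (l := [u 0])
      simp only [List.length_singleton] at this
      push_cast; omega
    · intro k
      obtain ⟨m, b, p, r, h, hNm⟩ := exists_position (sigma_ne_nil t) u N
      have hm : m < N := by
        rcases m with _ | m
        · exact hN
        · have := lt_length_imagePrefix_sigma (t := t) hu0 m
          omega
      obtain ⟨-, h2⟩ := onInf_at (sigma_ne_nil t) u h
      rw [← hNm, hu] at h2
      have hocc : Occ (sigma t) (u m) b (abel r) := ⟨p, r, h, rfl⟩
      rw [h2, map_sub, latticeProj_mulVec, map_sub, ← Module.End.mul_apply, ← pow_succ]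
      refine (norm_sub_le _ _).trans ((add_le_add (ih m hm (k + 1)) (hnorm _ (fun i =>
        (hocc.abs_le_length i).trans (by exact_mod_cast hlen (u m))) k)).trans_eq ?_)
      rw [pow_succ]
      field_simp
      ring

/-- Every tile is built from the subtiles by finite unions, translations and `M`, except `tile012`,
which is contained in `F 0 ∪ F 2`. -/
lemma decaysOn_dualSubtile {t : ℕ} {u : ℕ → Fin 5} (hu : (sigma t).onInf u = u) {ρ K : ℝ}
    (hρ0 : 0 < ρ) (hρ1 : ρ < 1) (hK0 : 0 ≤ K)
    (hK : ∀ (x : Fin 5 → ℝ) (k : ℕ), ‖(action (sigma t) ^ k) (piC t x)‖ ≤ K * ‖x‖ * ρ ^ k) :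
    ∃ L, ∀ a, ∀ x ∈ dualSubtile t u a, ∀ k, ‖(action (sigma t) ^ k) x‖ ≤ L * ρ ^ k := by
  have hF : ∀ c, DecaysOn (action (sigma t)) ρ (subtile t u c) := by
    intro c
    obtain ⟨L, hL⟩ := decaysOn_prefix hu hρ0 hρ1 hK0 hK
    refine ⟨L, ?_⟩
    rintro _ ⟨_, ⟨N, -, rfl⟩, rfl⟩ k
    exact hL N k
  have hv := decaysOn_latticeProj hK
  have h012 : DecaysOn (action (sigma t)) ρ (tile012 t (action (sigma t)).toAddMonoidHom
      (fun i => latticeProj t (Pi.single i 1)) (subtile t u)) :=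
    ((hF 0).union hρ0 (hF 2)).mono fun x hx =>
      ((isTileFamily_subtile hu).mem_zero_iff_tile012 x).2 (Or.inr hx)
  have h123 := h012.image
  have h234 := h123.image
  have h013 := ((hv (Pi.single 2 1)).translate (hF 0)).union hρ0 (hF 3)
  have h023 := (hF 0).union hρ0 ((hv (Pi.single 1 1)).translate (hF 3))
  have hT : ∀ a, DecaysOn (action (sigma t)) ρ (dualSubtile t u a) := by
    intro a
    unfold dualSubtile dualTile
    split_ifs
    · exact (hF 1).union hρ0 (hF 4)
    · exact (hF 3).union hρ0 (hF 0)
    · exact (hF 2).union hρ0 (((hv _).translate (hF 0)).union hρ0 ((hv _).translate (hF 4)))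
    · exact h023
    · exact h013
    · exact h012
    · exact h123.mono fun x ⟨y, hy, hx⟩ => ⟨y, hy, hx.symm⟩
    · exact h234.mono fun x ⟨y, hy, hx⟩ => ⟨_, ⟨y, hy, rfl⟩, hx.symm⟩
    · exact h013.image.mono fun x ⟨y, hy, hx⟩ => ⟨y, hy, hx.symm⟩
    · exact h023.image.mono fun x ⟨y, hy, hx⟩ => ⟨y, hy, hx.symm⟩
  choose L hL using hT
  refine ⟨∑ a, |L a|, fun a x hx k => (hL a x hx k).trans (mul_le_mul_of_nonneg_right ?_
    (by positivity))⟩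
  exact (le_abs_self _).trans (Finset.single_le_sum (f := fun a => |L a|)
      (fun _ _ => abs_nonneg _) (Finset.mem_univ a))

lemma dualSubtile_nonempty {t : ℕ} {u : ℕ → Fin 5} (hu : (sigma t).onInf u = u)
    (a : Finset (Fin 5)) : (dualSubtile t u a).Nonempty := by
  have h := isTileFamily_subtile hu
  have h0 : (subtile t u 0).Nonempty :=
    ⟨_, _, ⟨0, fixedPoint_sigma_zero hu, rfl⟩, rfl⟩
  have h1 : (subtile t u 1).Nonempty :=
    let ⟨x, hx⟩ := h0; ⟨_, (h.mem_one _).2 ⟨x, hx, rfl⟩⟩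
  have h2 : (subtile t u 2).Nonempty :=
    let ⟨x, hx⟩ := h1; ⟨_, (h.mem_two _).2 ⟨x, hx, rfl⟩⟩
  have h3 : (subtile t u 3).Nonempty :=
    let ⟨x, hx⟩ := h2; ⟨_, (h.mem_three _).2 ⟨x, hx, rfl⟩⟩
  obtain ⟨x0, h0⟩ := h0
  obtain ⟨x1, h1⟩ := h1
  obtain ⟨x2, h2⟩ := h2
  obtain ⟨x3, h3⟩ := h3
  unfold dualSubtile dualTile
  split_ifs
  · exact ⟨x1, Or.inl h1⟩
  · exact ⟨x3, Or.inl h3⟩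
  · exact ⟨x2, Or.inl h2⟩
  · exact ⟨x0, Or.inl h0⟩
  · exact ⟨x3, Or.inr h3⟩
  · exact ⟨x2, Or.inl h2⟩
  · exact ⟨_, x2, Or.inl h2, rfl⟩
  · exact ⟨_, x2, Or.inl h2, rfl⟩
  · exact ⟨_, x3, Or.inr h3, rfl⟩
  · exact ⟨_, x0, Or.inl h0, rfl⟩

/-! ### Convergence of the approximations -/

/-- Along a step, `M` maps the shifted position `z'` to `z + v`, and `M y - π v` lies in the
previous tile. The two occurrences of `v` cancel, so the difference of position and tile point is
simply transported by `M`. -/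
lemma exists_of_reach {t : ℕ} {u : ℕ → Fin 5} (hu : (sigma t).onInf u = u) {k : ℕ}
    {F G : (Fin 5 → ℤ) × Wedge 5 3} (h : Reach (sigma t) k F G) :
    ∀ y ∈ dualSubtile t u G.2.1, ∃ x ∈ dualSubtile t u F.2.1,
      (action (sigma t) ^ k) (latticeProj t (G.1 + G.2.vec) - y) =
        latticeProj t (F.1 + F.2.vec) - x := by
  induction k generalizing F with
  | zero =>
    obtain rfl : F = G := h
    exact fun y hy => ⟨y, hy, rfl⟩
  | succ k ih =>
    obtain ⟨H, ⟨v, hv, hH⟩, hG⟩ := h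
    intro y hy
    obtain ⟨z, hz, hyz⟩ := ih hG y hy
    refine ⟨_, (mem_dualSubtile_iff hu F.2 _).2 ⟨H.2, v, hv, z, hz, rfl⟩, ?_⟩
    rw [pow_succ', Module.End.mul_apply, hyz, map_sub, ← latticeProj_mulVec, hH, map_add]
    abel

/-- The converse of `exists_of_reach`: the set equation supplies the next type for a given tile
point, and unimodularity of `M` supplies an integral position for the face. -/
lemma exists_reach {t : ℕ} {u : ℕ → Fin 5} (hu : (sigma t).onInf u = u) (k : ℕ)
    (F : (Fin 5 → ℤ) × Wedge 5 3) : ∀ x ∈ dualSubtile t u F.2.1,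
    ∃ G, Reach (sigma t) k F G ∧ ∃ y ∈ dualSubtile t u G.2.1,
      (action (sigma t) ^ k) (latticeProj t (G.1 + G.2.vec) - y) =
        latticeProj t (F.1 + F.2.vec) - x := by
  induction k generalizing F with
  | zero => exact fun x hx => ⟨F, rfl, x, hx, rfl⟩
  | succ k ih =>
    intro x hx
    obtain ⟨b, v, hv, z, hz, rfl⟩ := (mem_dualSubtile_iff hu F.2 _).1 hx
    let H : (Fin 5 → ℤ) × Wedge 5 3 :=
      ((incidence (sigma t))⁻¹.mulVec (F.1 + F.2.vec + v) - b.vec, b)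
    have hH : (incidence (sigma t)).mulVec (H.1 + H.2.vec) = F.1 + F.2.vec + v := by
      simp only [H, sub_add_cancel]
      rw [Matrix.mulVec_mulVec, Matrix.mul_nonsing_inv _ (isUnit_det_incidence_sigma t),
        Matrix.one_mulVec]
    obtain ⟨G, hG, y, hy, hyz⟩ := ih H z hz
    refine ⟨G, ⟨H, ⟨v, hv, hH⟩, hG⟩, y, hy, ?_⟩
    rw [pow_succ', Module.End.mul_apply, hyz, map_sub, ← latticeProj_mulVec, hH, map_add]
    abel

/-- A face stays within a fixed distance of its base point, so under `M^k` its extent becomes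
negligible. -/
lemma piC_faceSupport {t : ℕ} {k : ℕ} {F : (Fin 5 → ℤ) × Wedge 5 k} {y : Fin 5 → ℝ}
    (hy : y ∈ faceSupport F) : ∃ z : Fin 5 → ℝ, ‖z‖ ≤ 1 ∧ piC t y = latticeProj t F.1 + piC t z := by
  obtain ⟨s, hs, rfl⟩ := hy
  refine ⟨_, ?_, map_add _ _ _⟩
  rw [pi_norm_le_iff_of_nonneg zero_le_one]
  intro i
  rw [Finset.sum_apply]
  simp only [Pi.smul_apply, Pi.single_apply, smul_eq_mul, mul_ite, mul_one, mul_zero,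
    Finset.sum_ite_eq]
  split_ifs
  · rw [Real.norm_eq_abs, abs_of_nonneg (hs i).1]; exact (hs i).2
  · simp

/-- The dual face starts at minus its own vector, so that its Poincaré image is based at the origin.
-/
lemma mem_rauzyApprox_iff {t : ℕ} {a : Wedge 5 2} {k : ℕ} {x : Fin 5 → ℝ} :
    x ∈ rauzyApprox t a k ↔ ∃ G, Reach (sigma t) k
      (-(a.star (show 2 + 3 = 5 from rfl)).vec, a.star (show 2 + 3 = 5 from rfl)) G ∧
      ∃ y ∈ faceSupport (G.1 + G.2.vec, G.2.star (show 3 + 2 = 5 from rfl)),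
        x = (action (sigma t) ^ k) (piC t y) := by
  have h := mem_chainSupport_geomDual_pow (show 3 + 2 = 5 from rfl)
    (isUnit_det_incidence_sigma t) (onlyEven_sigma t) k
    (-(a.star (show 2 + 3 = 5 from rfl)).vec, a.star (show 2 + 3 = 5 from rfl))
  simp only [neg_add_cancel, Wedge.star_star] at h
  simp only [rauzyApprox, Set.mem_image, h]
  constructor
  · rintro ⟨_, ⟨y, ⟨G, hG, hy⟩, rfl⟩, rfl⟩
    exact ⟨G, hG, y, hy, rfl⟩
  · rintro ⟨G, hG, y, hy, rfl⟩
    exact ⟨_, ⟨y, ⟨G, hG, hy⟩, rfl⟩, rfl⟩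

lemma faceSupport_nonempty {n k : ℕ} (F : (Fin n → ℤ) × Wedge n k) : (faceSupport F).Nonempty :=
  ⟨_, 0, fun _ => ⟨le_rfl, zero_le_one⟩, rfl⟩

/-- The shifted starting position is 0, so a face reached at `z` satisfies `M^k(π z - w) = -x` with
`w` and `x` in the tiles of the end and start types. A point of that face and `-x` then differ by
`M^k` of a bounded vector of `𝕂_c`. `exists_of_reach` and `exists_reach` give the two halves of the
Hausdorff distance. -/
theorem isHausdorffLimit_rauzyApprox {t : ℕ} {u : ℕ → Fin 5} (hu : (sigma t).onInf u = u)
    (a : Wedge 5 2) :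
    IsHausdorffLimit (rauzyApprox t a) (-closure (dualSubtile t u a.1ᶜ)) := by
  obtain ⟨ρ, hρ0, hρ1, K, hK0, hK⟩ := exists_contraction t
  obtain ⟨L, hL⟩ := decaysOn_dualSubtile hu hρ0 hρ1 hK0 hK
  set D := dualSubtile t u a.1ᶜ with hD
  have hneg : -closure D = closure (-D) := (Homeomorph.neg (Fin 5 → ℝ)).preimage_closure D
  have hbdd : Bornology.IsBounded (-D) := by
    refine (isBounded_iff_forall_norm_le.2 ⟨L, fun x hx => ?_⟩).neg
    simpa using hL _ x hx 0
  refine ⟨?_, ?_, ?_⟩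
  · rw [hneg, closure_nonempty_iff]
    exact (dualSubtile_nonempty hu _).neg
  · rw [hneg]
    exact hbdd.isCompact_closure
  · have hle : ∀ k, Metric.hausdorffEDist (rauzyApprox t a k) (-closure D) ≤
        ENNReal.ofReal ((K + L) * ρ ^ k) := by
      intro k
      -- The Hausdorff distance ignores closures, so the exact set equations before closure suffice.
      rw [hneg, Metric.hausdorffEDist_closure_right]
      have hdist : ∀ G : (Fin 5 → ℤ) × Wedge 5 3,
          ∀ y ∈ faceSupport (G.1 + G.2.vec, G.2.star (show 3 + 2 = 5 from rfl)),
          ∀ w ∈ dualSubtile t u G.2.1, ∀ x, (action (sigma t) ^ k)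
            (latticeProj t (G.1 + G.2.vec) - w) = -x →
          dist ((action (sigma t) ^ k) (piC t y)) (-x) ≤ (K + L) * ρ ^ k := by
        intro G y hy w hw x hx
        obtain ⟨z, hz, hyz⟩ := piC_faceSupport (t := t) hy
        rw [← hx, dist_eq_norm, ← map_sub, hyz]
        have : latticeProj t (G.1 + G.2.vec) + piC t z - (latticeProj t (G.1 + G.2.vec) - w) =
          piC t z + w := by abel
        rw [this, map_add, add_mul]
        refine (norm_add_le _ _).trans (add_le_add ((hK z k).trans ?_) (hL _ w hw k))
        exact mul_le_mul_of_nonneg_right (mul_le_of_le_one_right hK0 hz) (by positivity)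
      refine Metric.hausdorffEDist_le_of_mem_edist ?_ ?_
      · intro x hx
        obtain ⟨G, hG, y, hy, rfl⟩ := mem_rauzyApprox_iff.1 hx
        obtain ⟨w, hw⟩ := dualSubtile_nonempty hu G.2.1
        obtain ⟨x, hx, hxw⟩ := exists_of_reach hu hG w hw
        simp only [neg_add_cancel, map_zero, zero_sub] at hxw
        refine ⟨-x, Set.neg_mem_neg.2 hx, ?_⟩
        rw [edist_dist]
        exact ENNReal.ofReal_le_ofReal (hdist G y hy w hw x hxw)
      · intro x hx
        obtain ⟨G, hG, w, hw, hxw⟩ := exists_reach hu k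
          (-(a.star (show 2 + 3 = 5 from rfl)).vec, a.star (show 2 + 3 = 5 from rfl)) (-x) hx
        simp only [neg_add_cancel, map_zero, zero_sub] at hxw
        obtain ⟨y, hy⟩ := faceSupport_nonempty
          (G.1 + G.2.vec, G.2.star (show 3 + 2 = 5 from rfl))
        refine ⟨_, mem_rauzyApprox_iff.2 ⟨G, hG, y, hy, rfl⟩, ?_⟩
        rw [edist_comm, edist_dist]
        have := hdist G y hy w hw _ hxw
        rw [neg_neg] at this
        exact ENNReal.ofReal_le_ofReal this
    refine tendsto_of_tendsto_of_tendsto_of_le_of_le tendsto_const_nhds ?_ (fun _ => zero_le) hle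
    rw [← ENNReal.ofReal_zero]
    refine ENNReal.tendsto_ofReal ?_
    simpa using (tendsto_pow_atTop_nhds_zero_of_lt_one hρ0.le hρ1).const_mul (K + L)

/-! ### Comparison of the Rauzy fractals with the modified stepped line -/

lemma rauzyTile_eq {t : ℕ} {u : ℕ → Fin 5} (hu : (sigma t).onInf u = u) (a : Wedge 5 2) :
    rauzyTile t a = -closure (dualSubtile t u a.1ᶜ) :=
  (Classical.epsilon_spec ⟨_, isHausdorffLimit_rauzyApprox hu a⟩).unique
    (isHausdorffLimit_rauzyApprox hu a)

lemma isHausdorffLimit_rauzyTile {t : ℕ} {u : ℕ → Fin 5} (hu : (sigma t).onInf u = u)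
    (a : Wedge 5 2) : IsHausdorffLimit (rauzyApprox t a) (rauzyTile t a) :=
  Classical.epsilon_spec ⟨_, isHausdorffLimit_rauzyApprox hu a⟩

lemma lineTile_add_eq_neg_rauzyTile {t : ℕ} {u : ℕ → Fin 5} (hu : (sigma t).onInf u = u)
    {a : Fin 5} (ha : a ∈ ({1, 2, 3} : Finset (Fin 5))) {b : Wedge 5 2} (hb : b.1 = {1, 2, 3} \ {a}) :
    (fun x => x + piC t (Pi.single a 1)) '' lineTile t u a = -rauzyTile t b := by
  have hc : ∀ a ∈ ({1, 2, 3} : Finset (Fin 5)),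
      (({1, 2, 3} \ {a})ᶜ : Finset (Fin 5)) = {0, a, 4} := by decide
  rw [lineTile_add t u (by simpa using ha), rauzyTile_eq hu, neg_neg, hb, hc a ha]

lemma mem_support_elementP {F : (Fin 5 → ℤ) × Wedge 5 2} : F ∈ elementP.support ↔
    F.1 = 0 ∧ ∃ a ∈ ({1, 2, 3} : Finset (Fin 5)), F.2.1 = {1, 2, 3} \ {a} := by
  have h1 : (({1, 2, 3} \ {1} : Finset (Fin 5))) = {2, 3} := by decide
  have h2 : (({1, 2, 3} \ {2} : Finset (Fin 5))) = {1, 3} := by decide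
  have h3 : (({1, 2, 3} \ {3} : Finset (Fin 5))) = {1, 2} := by decide
  let b : Fin 3 → Wedge 5 2 := ![⟨{1, 2}, rfl⟩, ⟨{1, 3}, rfl⟩, ⟨{2, 3}, rfl⟩]
  have hsum : elementP = ∑ c, Finsupp.single (0, b c) 1 := by
    simp [Fin.sum_univ_three, elementP, b]
  have hF : F ∈ elementP.support ↔ F.1 = 0 ∧ ∃ c, F.2.1 = (b c).1 := by
    rw [hsum, mem_support_sum_of_nonneg fun _ _ => Finsupp.single_nonneg.2 zero_le_one]
    simp [Prod.ext_iff, Subtype.ext_iff]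
  rw [hF]
  simp [Fin.exists_fin_succ, b, h1, h2, h3]
  tauto

end Reducible

theorem mainTheorem7 (t : ℕ) (u : ℕ → Fin 5) (hu : (Reducible.sigma t).onInf u = u) :
    (∀ F ∈ Reducible.elementP.support,
      Reducible.IsHausdorffLimit (Reducible.rauzyApprox t F.2) (Reducible.rauzyTile t F.2)) ∧
    (∀ a ∈ ({1, 2, 3} : Finset (Fin 5)), ∀ bc : Reducible.Wedge 5 2,
      bc.1 = {1, 2, 3} \ {a} →
        (fun x => x + Reducible.piC t (Pi.single a 1)) '' Reducible.lineTile t u a =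
          -Reducible.rauzyTile t bc) ∧
    (⋃ a ∈ ({1, 2, 3} : Finset (Fin 5)), Reducible.lineTile t u a) =
      -((Reducible.domainExchange t Reducible.elementP).image
        (Reducible.rauzyUnion t Reducible.elementP)) := by
  refine ⟨fun F _ => Reducible.isHausdorffLimit_rauzyTile hu F.2,
    fun a ha bc hbc => Reducible.lineTile_add_eq_neg_rauzyTile hu ha hbc, ?_⟩
  have hmem : ∀ a ∈ ({1, 2, 3} : Finset (Fin 5)), ∀ bc : Reducible.Wedge 5 2,
      bc.1 = {1, 2, 3} \ {a} → ∀ x, x ∈ Reducible.lineTile t u a ↔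
        -(x + Reducible.piC t (Pi.single a 1)) ∈ Reducible.rauzyTile t bc := by
    intro a ha bc hbc x
    rw [← Set.mem_neg, ← Reducible.lineTile_add_eq_neg_rauzyTile hu ha hbc]
    exact ((add_left_injective _).mem_set_image (s := Reducible.lineTile t u a)).symm
  -- A face of type `{1, 2, 3} \ {l}` misses exactly the letter `l`, so the relation
  -- `domainExchange` translates its tile by `π_c(e_l)` only.
  have hsdiff : ∀ l ∈ ({1, 2, 3} : Finset (Fin 5)),
      ({1, 2, 3} : Finset (Fin 5)) \ ({1, 2, 3} \ {l}) = {l} := by decide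
  have hcard : ∀ l ∈ ({1, 2, 3} : Finset (Fin 5)), (({1, 2, 3} : Finset (Fin 5)) \ {l}).card = 2 := by
    decide
  have halph : Reducible.alphabet Reducible.elementP = {1, 2, 3} := by
    ext l
    simp only [Reducible.alphabet, Finset.mem_biUnion, Reducible.mem_support_elementP]
    constructor
    · rintro ⟨F, ⟨-, a, -, hF⟩, hl⟩
      rw [hF] at hl
      exact (Finset.mem_sdiff.1 hl).1
    · intro hl
      obtain ⟨a, ha, hla⟩ : ∃ a ∈ ({1, 2, 3} : Finset (Fin 5)), l ≠ a := by
        revert l; decide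
      exact ⟨(0, ⟨_, hcard a ha⟩), ⟨rfl, a, ha, rfl⟩, by simpa [hla] using hl⟩
  ext x
  simp only [Set.mem_iUnion, Set.mem_neg, SetRel.mem_image, Reducible.rauzyUnion,
    Reducible.domainExchange, Set.mem_ofPred_eq, Reducible.mem_support_elementP, halph, true_and,
    exists_prop]
  constructor
  · rintro ⟨a, ha, hx⟩
    have hx' := (hmem a ha ⟨_, hcard a ha⟩ rfl x).1 hx
    exact ⟨_, ⟨_, ⟨a, ha, rfl⟩, hx'⟩, _, ⟨a, ha, rfl⟩, hx', a, by simp [hsdiff a ha], by abel⟩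
  · rintro ⟨y, -, b, ⟨a, ha, hb⟩, hy, l, hl, hxy⟩
    rw [hb, hsdiff a ha, Finset.mem_singleton] at hl
    subst hl
    refine ⟨l, ha, (hmem l ha b hb x).2 ?_⟩
    rw [neg_add, hxy, add_neg_cancel_right]
    exact hy
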